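/- Let $n\ge 2$ be even, let $\mathbb{Z}_n=\{0,\dots,n-1\}$ with addition modulo $n$, and let $\Lambda\subset\mathbb{Z}_n\times\mathbb{Z}_n$ have cardinality $|\Lambda|=S$. For $\lambda=(k,\ell)\in\mathbb{Z}_n\times\mathbb{Z}_n$ let $\pi(\lambda)=M_\ell T_k$, where $(T_kh)_q=h_{k+q \bmod n}$ and $(M_\ell h)_q=e^{2\pi i\ell q/n}h_q$ for $h\in\mathbb{C}^n$, and for $g\in\mathbb{C}^n$ let $\Psi_g\in\mathbb{C}^{n\times n^2}$ be the matrix whose columns are the vectors $\pi(\lambda)g$, $\lambda\in\mathbb{Z}_n\times\mathbb{Z}_n$. Let $g=g^R$ be the random window $g_q=\epsilon_q/\sqrt n$, $q=0,\dots,n-1$, and let $x$ be a random vector in $\mathbb{C}^{\mathbb{Z}_n\times\mathbb{Z}_n}$ with $\operatorname{supp}(x)=\Lambda$ almost surely, such that the random variables $\epsilon_q$ ($q\in\mathbb{Z}_n$) and $\operatorname{sgn}(x_\lambda)=x_\lambda/|x_\lambda|$ ($\lambda\in\Lambda$) are all jointly independent and uniformly distributed on the torus $\{z\in\mathbb{C}:|z|=1\}$;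 no assumption is made on the moduli $|x_\lambda|$, $\lambda\in\Lambda$. Let $\sigma>8$. Say that Basis Pursuit recovers $x$ from $y=\Psi_gx$ if $x$ is the unique solution of $$\min_{z}\ \|z\|_1=\sum_{\lambda}|z_\lambda|\quad\text{subject to}\quad \Psi_gz=y,$$ and that it fails otherwise. Then the probability that Basis Pursuit fails to recover $x$ from $y=\Psi_g x$ is at most $$2(n^2-S)\exp\left(-\frac{n}{8\sigma S\log n}\right)+C\,S\exp\left(-\frac{n}{16eS}\right)+4n^{-(\sigma/4-2)},\qquad C=\frac{e^2}{4(e-1)}\approx 1.075,$$ where, in the trivial case $S=0$, the two fractions with $S$ in the denominator are read as $0$. -/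

import Mathlib

/-- Cyclic translation on `ℂⁿ`: `(T_k h)_q = h_{k+q mod n}`. -/
def translation {n : ℕ} (k : ZMod n) (h : ZMod n → ℂ) : ZMod n → ℂ :=
  fun q => h (k + q)

/-- Modulation on `ℂⁿ`: `(M_ℓ h)_q = e^{2πiℓq/n} h_q`, with `ℓ, q ∈ {0, …, n-1}`. -/
noncomputable def modulation {n : ℕ} (l : ZMod n) (h : ZMod n → ℂ) : ZMod n → ℂ :=
  fun q => Complex.exp (2 * Real.pi * Complex.I * (l.val : ℂ) * (q.val : ℂ) / (n : ℂ)) * h q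

/-- The time-frequency shift `π(λ) = M_ℓ T_k` for `λ = (k, ℓ)`. -/
noncomputable def timeFreqShift {n : ℕ} (lam : ZMod n × ZMod n) (h : ZMod n → ℂ) : ZMod n → ℂ :=
  modulation lam.2 (translation lam.1 h)

/-- The Gabor synthesis matrix `Ψ_g`, whose column with index `λ` is `π(λ) g`. -/
noncomputable def gaborMatrix {n : ℕ} (g : ZMod n → ℂ) :
    Matrix (ZMod n) (ZMod n × ZMod n) ℂ :=
  Matrix.of fun q lam => timeFreqShift lam g q

/-- The `ℓ₁`-norm of a finite complex vector. -/
noncomputable def l1Norm {ι : Type*} [Fintype ι] (z : ι → ℂ) : ℝ :=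
  ∑ i, ‖z i‖

/-- `z` is a minimizer of `‖·‖₁` subject to `A z = y` (a solution of Basis Pursuit). -/
def IsBasisPursuitSolution {κ ι : Type*} [Fintype ι] (A : Matrix κ ι ℂ) (y : κ → ℂ)
    (z : ι → ℂ) : Prop :=
  A.mulVec z = y ∧ ∀ w : ι → ℂ, A.mulVec w = y → l1Norm z ≤ l1Norm w

/-- Basis Pursuit recovers `x` from `A x`: the vector `x` is its one and only solution. -/
def BasisPursuitRecovers {κ ι : Type*} [Fintype ι] (A : Matrix κ ι ℂ) (x : ι → ℂ) : Prop :=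
  ∀ z : ι → ℂ, IsBasisPursuitSolution A (A.mulVec x) z ↔ z = x

/-- The complex sign `z / |z|`; it is `0` at `z = 0`, since `0 / 0 = 0`. -/
noncomputable def complexSgn (z : ℂ) : ℂ := z / (‖z‖ : ℂ)

/-- The uniform probability distribution on the torus `{z ∈ ℂ : |z| = 1}`: the law of `e^{iθ}`
with `θ` uniformly distributed on `[0, 2π)`. -/
noncomputable def torusUniform : MeasureTheory.Measure ℂ :=
  (ProbabilityTheory.cond MeasureTheory.volume (Set.Ico (0 : ℝ) (2 * Real.pi))).map
    fun θ : ℝ => Complex.exp (θ * Complex.I)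

/-- The window with entries `g_q = ε_q / √n`. -/
noncomputable def normalizedWindow {n : ℕ} (ε : ZMod n → ℂ) : ZMod n → ℂ :=
  fun q => (1 / (Real.sqrt n : ℂ)) * ε q

/-!
Write `Ψ` for the Gabor matrix of the window `ε / √n`, `Ψ_Λ` for its columns with indices in `Λ`, and
`S` for the cardinality of `Λ`. By convex duality Basis Pursuit recovers `x` as soon as `Ψ_Λ` is
injective and some `w` satisfies `Ψ_Λ* w = sgn x` and `|(Ψ* w)_ρ| < 1` for all `ρ ∉ Λ`
(`basisPursuitRecovers_of_certificate`). The least squares candidate is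
`w = Ψ_Λ (Ψ_Λ* Ψ_Λ)⁻¹ sgn x`. For a fixed window each `(Ψ* w)_ρ` is a linear form in the independent
signs of `x`, whose coefficients have square sum at most
`‖(Ψ_Λ* Ψ_Λ)⁻¹‖² · S · max |⟨ψ_λ, ψ_ρ⟩|²` (`sum_norm_sq_certificateMatrix_le`), so that its modulus
reaches `1` with small probability. Each of the three terms of the bound pays for one ingredient.

* The signs. A sum of independent phases with coefficients `c` has moments at most
  `m! (∑ |c|²)ᵐ` (`integral_norm_sum_mul_phase_pow_le`), hence a sub-Gaussian tail
  (`measureReal_le_norm_of_moments`). The first term is a union bound over `ρ ∉ Λ`, conditionally on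
  a good window.
* The conditioning of `Ψ_Λ* Ψ_Λ = 1 + H`. If `Tr H^(2m) < 4⁻ᵐ` then `‖H‖ < 1/2` and the inverse has
  norm at most `2` (`sum_norm_sq_le_of_trace_pow_lt`). The moments `E Tr H^(2m)` are estimated by
  integration by parts in the angles of the window. The entries of `H` are combinations of products
  `ε_r conj ε_s` with `r ≠ s`, so `∑_q ∂_q² H = - 2 H`; with `D_q = ∂_q H` this gives
  `2 E Tr H^(2s+2) = E ∑_q ∑_j Tr (D_q H^j D_q H^(2s-j))` (`two_mul_integral_gramTrace`). Collecting
  the powers of `H` on one side leaves `∑_q D_q²`, which is dominated by `2 ∑_q (U_q U_q* + U_q* U_q)`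
  where `U_q = ε_q Ψ_Λ* B_q` and `B_q` is the coefficient of `ε_q` in `Ψ_Λ`. Here
  `∑_q U_q U_q* = (S / n) (1 + H)`, while `∑_q U_q* U_q` is `S / n` times an average of unitary
  conjugates of the transposed Gram matrix of the reflected window
  (`sum_conjTranspose_gaborCoeff_mul_mul`), which has the same law. Young's inequality for traces
  closes the recursion `gramMoment_succ_le`, and Markov's inequality with `m ≈ n / (16 e S)` gives the
  second term.
* The coherence. An inner product of two distinct columns is, up to a unimodular factor, an
  autocorrelation `n⁻¹ ∑_r e^(2πilr/n) ε_(r+k) conj ε_r`. It vanishes for `k = 0`. Otherwise it splits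
  into the summands with and without wrap-around, and in each part every summand brings in a new
  phase when they are added in the right order, so that the same moment bound applies
  (`measureReal_le_norm_autocorrelation`). A union bound over the `n²` shifts gives the third term.
-/

open MeasureTheory AddCircle
open scoped ComplexConjugate Matrix

/-! ### Integration over independent uniform phases -/

instance factTwoPiPos : Fact (0 < 2 * Real.pi) := ⟨Real.two_pi_pos⟩

/-- The law of a family `(θ_i)` of independent uniformly distributed angles. -/
noncomputable def phaseMeasure (I : Type*) [Fintype I] : Measure (I → AddCircle (2 * Real.pi)) :=
  Measure.pi fun _ => haarAddCircle

/-- The point `e^{ix}` of the torus with angle `x`. -/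
noncomputable def phase (x : AddCircle (2 * Real.pi)) : ℂ := (toCircle x : ℂ)

lemma norm_phase (x : AddCircle (2 * Real.pi)) : ‖phase x‖ = 1 := by
  rw [phase, Circle.norm_coe]

lemma phase_zero : phase 0 = 1 := by simp [phase]

lemma phase_add (x y : AddCircle (2 * Real.pi)) : phase (x + y) = phase x * phase y := by
  simp [phase, toCircle_add]

@[fun_prop]
lemma continuous_phase : Continuous phase :=
  continuous_subtype_val.comp continuous_toCircle

lemma conj_phase_mul_self (x : AddCircle (2 * Real.pi)) : conj (phase x) * phase x = 1 := by
  rw [Complex.conj_mul', norm_phase]; simp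

lemma hasDerivAt_phase (t : ℝ) :
    HasDerivAt (fun t : ℝ => phase (t : AddCircle (2 * Real.pi)))
      (Complex.I * phase (t : AddCircle (2 * Real.pi))) t := by
  have h : ∀ t : ℝ, phase (t : AddCircle (2 * Real.pi)) = Complex.exp (t * Complex.I) := by
    intro t
    rw [phase, toCircle_apply_mk, div_self (by positivity), one_mul, Circle.coe_exp]
  simp only [h]
  have := ((Complex.ofRealCLM.hasDerivAt (x := t)).mul_const Complex.I).cexp
  simpa [mul_comm] using this

instance (I : Type*) [Fintype I] : IsProbabilityMeasure (phaseMeasure I) := by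
  unfold phaseMeasure; infer_instance

instance : (haarAddCircle : Measure (AddCircle (2 * Real.pi))).IsAddLeftInvariant := by
  unfold haarAddCircle; infer_instance

instance (I : Type*) [Fintype I] : (phaseMeasure I).IsAddLeftInvariant := by
  unfold phaseMeasure; infer_instance

lemma integrable_phaseMeasure {I : Type*} [Fintype I] {E : Type*} [NormedAddCommGroup E]
    {f : (I → AddCircle (2 * Real.pi)) → E} (hf : Continuous f) :
    Integrable f (phaseMeasure I) :=
  hf.integrable_of_hasCompactSupport (HasCompactSupport.of_compactSpace f)

/-- The family of angles which is `x` at `q` and `0` elsewhere. -/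
noncomputable def singleAngle {I : Type*} [DecidableEq I] (q : I) (x : AddCircle (2 * Real.pi)) :
    I → AddCircle (2 * Real.pi) := Pi.single q x

lemma singleAngle_add {I : Type*} [DecidableEq I] (q : I) (x y : AddCircle (2 * Real.pi)) :
    singleAngle q (x + y) = singleAngle q x + singleAngle q y := by
  simp [singleAngle, Pi.single_add]

lemma singleAngle_zero {I : Type*} [DecidableEq I] (q : I) : singleAngle q 0 = 0 := by
  simp [singleAngle]

lemma singleAngle_self {I : Type*} [DecidableEq I] (q : I) (x : AddCircle (2 * Real.pi)) :
    singleAngle q x q = x := by simp [singleAngle]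

lemma singleAngle_of_ne {I : Type*} [DecidableEq I] {q r : I} (h : r ≠ q)
    (x : AddCircle (2 * Real.pi)) : singleAngle q x r = 0 := by
  simp [singleAngle, h]

lemma continuous_singleAngle {I : Type*} [DecidableEq I] (q : I) :
    Continuous (singleAngle q) :=
  continuous_single (A := fun _ : I => AddCircle (2 * Real.pi)) q

/-- Since the law of the angles is invariant under translations, an integral over all angles may
be computed by averaging over one angle first. -/
lemma integral_phaseMeasure_eq_average {I : Type*} [Fintype I] [DecidableEq I]
    {E : Type*} [NormedAddCommGroup E] [NormedSpace ℝ E] [CompleteSpace E] (q : I)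
    {f : (I → AddCircle (2 * Real.pi)) → E} (hf : Continuous f) :
    ∫ θ, f θ ∂phaseMeasure I =
      ∫ θ, ∫ s, f (θ + singleAngle q s) ∂haarAddCircle ∂phaseMeasure I := by
  rw [integral_integral_swap_of_hasCompactSupport
    (f := fun (θ : I → AddCircle (2 * Real.pi)) (s : AddCircle (2 * Real.pi)) =>
      f (θ + singleAngle q s))]
  · have h : ∀ s : AddCircle (2 * Real.pi),
        ∫ θ, f (θ + singleAngle q s) ∂phaseMeasure I = ∫ θ, f θ ∂phaseMeasure I := by
      intro s
      simp_rw [add_comm _ (singleAngle q s)]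
      exact integral_add_left_eq_self f _
    simp [h]
  · have h : Continuous fun p : (I → AddCircle (2 * Real.pi)) × AddCircle (2 * Real.pi) =>
        p.1 + singleAngle q p.2 :=
      continuous_fst.add ((continuous_singleAngle q).comp continuous_snd)
    exact hf.comp h
  · exact HasCompactSupport.of_compactSpace _

/-- The derivative of a function of the angles with respect to one of them has mean zero. -/
lemma integral_phaseMeasure_deriv_eq_zero {I : Type*} [Fintype I] [DecidableEq I] (q : I)
    {f f' : (I → AddCircle (2 * Real.pi)) → ℂ} (hf' : Continuous f')
    (h : ∀ θ, HasDerivAt (fun t : ℝ => f (θ + singleAngle q (t : AddCircle (2 * Real.pi))))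
      (f' θ) 0) :
    ∫ θ, f' θ ∂phaseMeasure I = 0 := by
  rw [integral_phaseMeasure_eq_average q hf']
  refine integral_eq_zero_of_ae (Filter.Eventually.of_forall fun θ => ?_)
  have hd : ∀ t : ℝ, HasDerivAt (fun t : ℝ => f (θ + singleAngle q (t : AddCircle (2 * Real.pi))))
      (f' (θ + singleAngle q (t : AddCircle (2 * Real.pi)))) t := by
    intro t
    have h1 := h (θ + singleAngle q (t : AddCircle (2 * Real.pi)))
    have h2 : HasDerivAt (fun u : ℝ => u - t) 1 t := (hasDerivAt_id t).sub_const t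
    have h3 := HasDerivAt.scomp_of_eq (h := fun u : ℝ => u - t) t h1 h2 (by simp)
    simp only [one_smul] at h3
    refine h3.congr_of_eventuallyEq (Filter.Eventually.of_forall fun u => ?_)
    simp only [Function.comp_apply, add_assoc, ← singleAngle_add, ← AddCircle.coe_add]
    simp
  have hc : Continuous fun s : AddCircle (2 * Real.pi) => f' (θ + singleAngle q s) :=
    hf'.comp (continuous_const.add (continuous_singleAngle q))
  show ∫ s, f' (θ + singleAngle q s) ∂haarAddCircle = 0
  rw [integral_haarAddCircle,
    ← AddCircle.intervalIntegral_preimage (2 * Real.pi) 0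
      (fun s => f' (θ + singleAngle q s)),
    intervalIntegral.integral_eq_sub_of_hasDerivAt (fun t _ => hd t)]
  · have h0 : ((2 * Real.pi : ℝ) : AddCircle (2 * Real.pi)) = 0 := AddCircle.coe_period _
    rw [zero_add, h0, AddCircle.coe_zero, sub_self, smul_zero]
  · exact (hc.comp (AddCircle.continuous_mk' _)).intervalIntegrable _ _

/-! ### Moments of sums of independent phases -/

lemma integral_phase_pow_mul_conj_pow (j k : ℕ) :
    ∫ s, phase s ^ j * conj (phase s) ^ k ∂haarAddCircle = if j = k then 1 else 0 := by
  have h : ∀ s, phase s ^ j * conj (phase s) ^ k =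
      fourier (-0) s • (fourier ((j : ℤ) - k) s : ℂ) := by
    intro s
    have h1 : conj (phase s) = (phase s)⁻¹ :=
      (inv_eq_of_mul_eq_one_left (conj_phase_mul_self s)).symm
    have h0 : phase s ≠ 0 := by
      intro h0; simpa [h0] using norm_phase s
    rw [neg_zero, fourier_zero, one_smul, fourier_apply, toCircle_zsmul, Circle.coe_zpow]
    change _ = phase s ^ ((j : ℤ) - k)
    rw [h1, zpow_sub₀ h0, inv_pow]; simp [div_eq_mul_inv]
  simp_rw [h]
  change fourierCoeff (fourier ((j : ℤ) - k)) 0 = _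
  rw [fourierCoeff_fourier]
  by_cases hjk : j = k
  · simp [hjk]
  · rw [if_neg hjk, Pi.single_eq_of_ne]
    omega

/-- Parseval's identity for the trigonometric polynomial `(x + a e^{is})^m`. -/
lemma integral_norm_add_mul_phase_pow (x a : ℂ) (m : ℕ) :
    ∫ s, ‖x + a * phase s‖ ^ (2 * m) ∂haarAddCircle =
      ∑ j ∈ Finset.range (m + 1), (m.choose j : ℝ) ^ 2 * (‖a‖ ^ 2) ^ j * (‖x‖ ^ 2) ^ (m - j) := by
  have key : ∀ s, ((‖x + a * phase s‖ ^ (2 * m) : ℝ) : ℂ) =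
      ∑ j ∈ Finset.range (m + 1), ∑ k ∈ Finset.range (m + 1),
        (a ^ j * x ^ (m - j) * m.choose j * conj (a ^ k * x ^ (m - k) * m.choose k)) *
          (phase s ^ j * conj (phase s) ^ k) := by
    intro s
    have h : ((‖x + a * phase s‖ ^ (2 * m) : ℝ) : ℂ) =
        (a * phase s + x) ^ m * conj ((a * phase s + x) ^ m) := by
      rw [Complex.mul_conj', norm_pow, add_comm x]; push_cast; ring
    rw [h, add_pow, map_sum, Finset.sum_mul_sum]
    refine Finset.sum_congr rfl fun j _ => Finset.sum_congr rfl fun k _ => ?_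
    simp only [map_mul, map_pow, mul_pow]
    ring
  have hc : ∀ j k : ℕ, ∀ c : ℂ, Integrable (fun s => c * (phase s ^ j * conj (phase s) ^ k))
      haarAddCircle := fun j k c =>
    Continuous.integrable_of_hasCompactSupport
      (by have := Complex.continuous_conj; fun_prop) (HasCompactSupport.of_compactSpace _)
  have h2 : ((∫ s, ‖x + a * phase s‖ ^ (2 * m) ∂haarAddCircle : ℝ) : ℂ) =
      ((∑ j ∈ Finset.range (m + 1),
        (m.choose j : ℝ) ^ 2 * (‖a‖ ^ 2) ^ j * (‖x‖ ^ 2) ^ (m - j) : ℝ) : ℂ) := by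
    rw [← integral_complex_ofReal]
    simp_rw [key]
    rw [integral_finsetSum _ fun j _ => integrable_finsetSum _ fun k _ => hc j k _]
    push_cast
    refine Finset.sum_congr rfl fun j hj => ?_
    rw [integral_finsetSum _ fun k _ => hc j k _]
    simp_rw [integral_const_mul, integral_phase_pow_mul_conj_pow]
    simp only [mul_ite, mul_one, mul_zero, Finset.sum_ite_eq, hj, if_true]
    rw [← Complex.mul_conj' a, ← Complex.mul_conj' x]
    simp only [map_mul, map_pow, mul_pow, Complex.conj_natCast]
    ring
  exact_mod_cast h2

/-- The Khintchine inequality with constant `m!` for sums `∑ A_j e^{iθ_{φ j}}` in which every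
coefficient is bounded and every summand brings in an angle on which neither the earlier summands
nor its own coefficient depend. Averaging over the newest angle is Parseval's identity, and the
induction closes because `(m choose j) (m - j)! ≤ m!`. -/
lemma integral_norm_sum_mul_phase_pow_le {I J : Type*} [Fintype I] [DecidableEq I] [LinearOrder J]
    (φ : J → I) (A : J → (I → AddCircle (2 * Real.pi)) → ℂ) (c : J → ℝ)
    (hA : ∀ j, Continuous (A j)) (hc : ∀ j θ, ‖A j θ‖ ^ 2 ≤ c j) (s : Finset J)
    (hindep : ∀ j ∈ s, ∀ i ∈ s, i ≤ j → ∀ θ x, A i (θ + singleAngle (φ j) x) = A i θ)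
    (hφ : ∀ j ∈ s, ∀ i ∈ s, i < j → φ i ≠ φ j) (m : ℕ) :
    ∫ θ, ‖∑ j ∈ s, A j θ * phase (θ (φ j))‖ ^ (2 * m) ∂phaseMeasure I ≤
      m.factorial * (∑ j ∈ s, c j) ^ m := by
  have hc0 : ∀ j, 0 ≤ c j := fun j => (sq_nonneg _).trans (hc j 0)
  induction s using Finset.induction_on_max generalizing m with
  | empty =>
    rcases m with _ | m
    · simp
    · simp
  | insert a s has ih =>
    have has' : a ∉ s := fun h => lt_irrefl _ (has a h)
    have ih' := ih (fun j hj i hi => hindep j (Finset.mem_insert_of_mem hj) i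
      (Finset.mem_insert_of_mem hi)) (fun j hj i hi => hφ j (Finset.mem_insert_of_mem hj) i
      (Finset.mem_insert_of_mem hi))
    set X : (I → AddCircle (2 * Real.pi)) → ℂ := fun θ => ∑ j ∈ s, A j θ * phase (θ (φ j)) with hX
    have hXc : Continuous X := by
      refine continuous_finsetSum _ fun j _ => ?_
      have := hA j
      fun_prop
    have hXi : ∀ θ x, X (θ + singleAngle (φ a) x) = X θ := by
      intro θ x
      refine Finset.sum_congr rfl fun j hj => ?_
      rw [hindep a (Finset.mem_insert_self _ _) j (Finset.mem_insert_of_mem hj) (has j hj).le]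
      have hne : φ j ≠ φ a := hφ a (Finset.mem_insert_self _ _) j (Finset.mem_insert_of_mem hj)
        (has j hj)
      rw [Pi.add_apply, singleAngle_of_ne hne, add_zero]
    have hAi : ∀ θ x, A a (θ + singleAngle (φ a) x) = A a θ :=
      hindep a (Finset.mem_insert_self _ _) a (Finset.mem_insert_self _ _) le_rfl
    simp only [Finset.sum_insert has']
    have hcont : Continuous fun θ : I → AddCircle (2 * Real.pi) =>
        ‖A a θ * phase (θ (φ a)) + X θ‖ ^ (2 * m) := by
      have := hA a
      fun_prop
    have havg : ∀ θ, ∫ x, ‖A a (θ + singleAngle (φ a) x) *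
          phase ((θ + singleAngle (φ a) x) (φ a)) + X (θ + singleAngle (φ a) x)‖ ^ (2 * m)
            ∂haarAddCircle =
        ∑ j ∈ Finset.range (m + 1),
          (m.choose j : ℝ) ^ 2 * (‖A a θ‖ ^ 2) ^ j * (‖X θ‖ ^ 2) ^ (m - j) := by
      intro θ
      have h := integral_norm_add_mul_phase_pow (X θ) (A a θ * phase (θ (φ a))) m
      rw [norm_mul, norm_phase, mul_one] at h
      rw [← h]
      refine integral_congr_ae (Filter.Eventually.of_forall fun x => ?_)
      simp only [hXi, hAi, Pi.add_apply, singleAngle_self, phase_add]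
      rw [add_comm, mul_assoc]
    have hint : ∀ j : ℕ, Continuous fun θ : I → AddCircle (2 * Real.pi) =>
        (‖X θ‖ ^ 2) ^ (m - j) := fun j => by fun_prop
    rw [integral_phaseMeasure_eq_average (φ a) hcont]
    simp only [havg]
    calc ∫ θ, ∑ j ∈ Finset.range (m + 1),
          (m.choose j : ℝ) ^ 2 * (‖A a θ‖ ^ 2) ^ j * (‖X θ‖ ^ 2) ^ (m - j) ∂phaseMeasure I
        ≤ ∫ θ, ∑ j ∈ Finset.range (m + 1),
          (m.choose j : ℝ) ^ 2 * c a ^ j * (‖X θ‖ ^ 2) ^ (m - j) ∂phaseMeasure I := by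
          refine integral_mono (integrable_phaseMeasure ?_) (integrable_phaseMeasure ?_)
            fun θ => ?_
          · have := hA a
            fun_prop
          · fun_prop
          · refine Finset.sum_le_sum fun j _ => ?_
            have := hc a θ
            gcongr
      _ = ∑ j ∈ Finset.range (m + 1), (m.choose j : ℝ) ^ 2 * c a ^ j *
            ∫ θ, ‖X θ‖ ^ (2 * (m - j)) ∂phaseMeasure I := by
          rw [integral_finsetSum _ fun j _ => (integrable_phaseMeasure (hint j)).const_mul _]
          refine Finset.sum_congr rfl fun j _ => ?_
          rw [integral_const_mul]
          simp only [pow_mul]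
      _ ≤ ∑ j ∈ Finset.range (m + 1), (m.factorial : ℝ) *
            (c a ^ j * (∑ j ∈ s, c j) ^ (m - j) * m.choose j) := by
          refine Finset.sum_le_sum fun j hj => ?_
          have hjm : j ≤ m := Nat.lt_succ_iff.mp (Finset.mem_range.mp hj)
          have h1 : (m.choose j : ℝ) * (m - j).factorial ≤ m.factorial := by
            have h2 := Nat.choose_mul_factorial_mul_factorial hjm
            have h3 : m.choose j * (m - j).factorial ≤ m.factorial := by
              rw [← h2]
              have := Nat.factorial_pos j
              nlinarith [Nat.zero_le (m.choose j * (m - j).factorial)]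
            exact_mod_cast h3
          have h4 : 0 ≤ ∑ j ∈ s, c j := Finset.sum_nonneg fun j _ => hc0 j
          calc (m.choose j : ℝ) ^ 2 * c a ^ j * ∫ θ, ‖X θ‖ ^ (2 * (m - j)) ∂phaseMeasure I
              ≤ (m.choose j : ℝ) ^ 2 * c a ^ j *
                  ((m - j).factorial * (∑ j ∈ s, c j) ^ (m - j)) := by
                have := hc0 a
                exact mul_le_mul_of_nonneg_left (ih' (m - j)) (by positivity)
            _ = (m.choose j * (m - j).factorial : ℝ) *
                  (c a ^ j * (∑ j ∈ s, c j) ^ (m - j) * m.choose j) := by ring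
            _ ≤ _ := by
                have := hc0 a
                exact mul_le_mul_of_nonneg_right h1 (by positivity)
      _ = m.factorial * (c a + ∑ j ∈ s, c j) ^ m := by
          rw [← Finset.mul_sum, add_pow]

/-- Moments growing at most like those of a complex Gaussian variable force a sub-Gaussian tail:
`|X|² / (2v)` has exponential moment at most `∑ 2⁻ᵐ = 2`. -/
lemma measureReal_le_norm_of_moments {I : Type*} [Fintype I]
    {X : (I → AddCircle (2 * Real.pi)) → ℂ} (hX : Continuous X) {v : ℝ} (hv : 0 < v)
    (hm : ∀ m : ℕ, ∫ θ, ‖X θ‖ ^ (2 * m) ∂phaseMeasure I ≤ m.factorial * v ^ m)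
    {u : ℝ} (hu : 0 ≤ u) :
    (phaseMeasure I).real {θ | u ≤ ‖X θ‖} ≤ 2 * Real.exp (-(u ^ 2 / (2 * v))) := by
  set f : (I → AddCircle (2 * Real.pi)) → ℝ := fun θ => Real.exp (‖X θ‖ ^ 2 / (2 * v)) with hf
  have hfc : Continuous f := by fun_prop
  have hexp : ∫ θ, f θ ∂phaseMeasure I ≤ 2 := by
    have hle : ∀ m : ℕ, ∫ θ, (‖X θ‖ ^ 2 / (2 * v)) ^ m / m.factorial ∂phaseMeasure I ≤
        (1 / 2) ^ m := by
      intro m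
      have h2 : ∀ θ, (‖X θ‖ ^ 2 / (2 * v)) ^ m / m.factorial =
          (1 / ((2 * v) ^ m * m.factorial)) * ‖X θ‖ ^ (2 * m) := by
        intro θ; rw [div_pow, pow_mul]; field_simp
      simp_rw [h2]
      rw [integral_const_mul]
      calc _ ≤ (1 / ((2 * v) ^ m * m.factorial)) * (m.factorial * v ^ m) :=
            mul_le_mul_of_nonneg_left (hm m) (by positivity)
        _ = (1 / 2) ^ m := by
            rw [mul_pow, one_div_pow]
            have := Nat.factorial_ne_zero m
            field_simp
    have h1 : HasSum (fun m : ℕ => ∫ θ, (‖X θ‖ ^ 2 / (2 * v)) ^ m / m.factorial ∂phaseMeasure I)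
        (∫ θ, f θ ∂phaseMeasure I) := by
      have hfun : ∀ θ, f θ = ∑' m : ℕ, (‖X θ‖ ^ 2 / (2 * v)) ^ m / m.factorial := by
        intro θ
        simp only [hf, Real.exp_eq_exp_ℝ, NormedSpace.exp_eq_tsum_div]
      simp_rw [hfun]
      refine hasSum_integral_of_summable_integral_norm
        (fun m => integrable_phaseMeasure (by fun_prop)) ?_
      refine Summable.of_nonneg_of_le (fun m => integral_nonneg fun θ => norm_nonneg _)
        (fun m => ?_) summable_geometric_two
      refine le_trans (le_of_eq ?_) (hle m)
      refine integral_congr_ae (Filter.Eventually.of_forall fun θ => ?_)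
      exact Real.norm_of_nonneg (by positivity)
    exact (hasSum_le hle h1 hasSum_geometric_two)
  have hmarkov := mul_meas_ge_le_integral_of_nonneg (μ := phaseMeasure I) (f := f)
    (Filter.Eventually.of_forall fun θ => (Real.exp_pos _).le) (integrable_phaseMeasure hfc)
    (Real.exp (u ^ 2 / (2 * v)))
  have hsub : {θ | u ≤ ‖X θ‖} ⊆ {θ | Real.exp (u ^ 2 / (2 * v)) ≤ f θ} := by
    intro θ hθ
    have hθ' : u ≤ ‖X θ‖ := hθ
    simp only [hf, Set.mem_ofPred_eq]
    gcongr
  have h3 := measureReal_mono (μ := phaseMeasure I) hsub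
  rw [Real.exp_neg, ← div_eq_mul_inv, le_div_iff₀ (Real.exp_pos _)]
  nlinarith [Real.exp_pos (u ^ 2 / (2 * v))]

/-! ### Autocorrelations of the window -/

/-- The summands `c_r ε_{r+k} conj ε_r` without wrap-around, `r + k < n`: when `r` increases, the
phase `ε_{r+k}` is new at every step. -/
lemma measureReal_le_norm_autocorrelation_noWrap {n : ℕ} [NeZero n] {k : ZMod n} (hk : k ≠ 0)
    (c : ZMod n → ℂ) (hc : ∀ r, ‖c r‖ ≤ 1) {u : ℝ} (hu : 0 ≤ u)
    (s : Finset (ZMod n)) (hs : ∀ r ∈ s, r.val + k.val < n) (hs0 : s.Nonempty) :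
    (phaseMeasure (ZMod n)).real
      {θ | u ≤ ‖∑ r ∈ s, c r * phase (θ (r + k)) * conj (phase (θ r))‖} ≤
      2 * Real.exp (-(u ^ 2 / (2 * s.card))) := by
  let _ : LinearOrder (ZMod n) := LinearOrder.lift' ZMod.val (ZMod.val_injective n)
  have hkpos : 0 < k.val := Nat.pos_of_ne_zero fun h => hk ((ZMod.val_eq_zero k).mp h)
  have hcs : (0 : ℝ) < s.card := by exact_mod_cast hs0.card_pos
  have hcj := Complex.continuous_conj
  refine measureReal_le_norm_of_moments (by fun_prop) hcs (fun m => ?_) hu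
  have h := integral_norm_sum_mul_phase_pow_le (I := ZMod n) (fun r : ZMod n => r + k)
    (fun r θ => c r * conj (phase (θ r))) (fun _ => 1) (fun r => by fun_prop)
    (fun r θ => by
      rw [norm_mul, RCLike.norm_conj, norm_phase, mul_one]
      exact pow_le_one₀ (norm_nonneg _) (hc r)) s
    (fun j hj i _ hij θ x => by
      have hij' : i.val ≤ j.val := hij
      have hne : i ≠ j + k := by
        intro h
        rw [h, ZMod.val_add_of_lt (hs j hj)] at hij'
        omega
      simp only [Pi.add_apply, singleAngle_of_ne hne, add_zero])
    (fun j _ i _ hij h => hij.ne (add_right_cancel h)) m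
  simpa [mul_right_comm] using h

/-- The summands `c_r ε_{r+k} conj ε_r` with wrap-around, `n ≤ r + k`: when `r` increases, the
phase `ε_r` is new at every step, since `r + k - n < r`. -/
lemma measureReal_le_norm_autocorrelation_wrap {n : ℕ} [NeZero n] {k : ZMod n}
    (c : ZMod n → ℂ) (hc : ∀ r, ‖c r‖ ≤ 1) {u : ℝ} (hu : 0 ≤ u)
    (s : Finset (ZMod n)) (hs : ∀ r ∈ s, n ≤ r.val + k.val) (hs0 : s.Nonempty) :
    (phaseMeasure (ZMod n)).real
      {θ | u ≤ ‖∑ r ∈ s, c r * phase (θ (r + k)) * conj (phase (θ r))‖} ≤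
      2 * Real.exp (-(u ^ 2 / (2 * s.card))) := by
  let _ : LinearOrder (ZMod n) := LinearOrder.lift' ZMod.val (ZMod.val_injective n)
  have hcs : (0 : ℝ) < s.card := by exact_mod_cast hs0.card_pos
  have hcj := Complex.continuous_conj
  refine measureReal_le_norm_of_moments (by fun_prop) hcs (fun m => ?_) hu
  have h := integral_norm_sum_mul_phase_pow_le (I := ZMod n) (fun r : ZMod n => r)
    (fun r θ => conj (c r) * conj (phase (θ (r + k)))) (fun _ => 1) (fun r => by fun_prop)
    (fun r θ => by
      rw [norm_mul, RCLike.norm_conj, RCLike.norm_conj, norm_phase, mul_one]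
      exact pow_le_one₀ (norm_nonneg _) (hc r)) s
    (fun j hj i hi hij θ x => by
      have hij' : i.val ≤ j.val := hij
      have hne : i + k ≠ j := by
        intro h
        have h1 := ZMod.val_add_val_of_le (hs i hi)
        have h2 := ZMod.val_lt k
        rw [h] at h1
        omega
      simp only [Pi.add_apply, singleAngle_of_ne hne, add_zero])
    (fun j _ i _ hij h => hij.ne h) m
  have hconj : ∀ θ : ZMod n → AddCircle (2 * Real.pi),
      ‖∑ r ∈ s, c r * phase (θ (r + k)) * conj (phase (θ r))‖ =
      ‖∑ r ∈ s, conj (c r) * conj (phase (θ (r + k))) * phase (θ r)‖ := by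
    intro θ
    rw [← RCLike.norm_conj, map_sum]
    simp only [map_mul, Complex.conj_conj]
  simp only [hconj]
  simpa using h

/-- Tail bound for an autocorrelation of the window. The threshold `u` is shared among the
summands without and with wrap-around in proportion to the square roots of their numbers `a`, `b`;
the bound then follows from `(√a + √b)² ≤ 2 (a + b) = 2 n`. -/
lemma measureReal_le_norm_autocorrelation {n : ℕ} [NeZero n] {k : ZMod n} (hk : k ≠ 0)
    (c : ZMod n → ℂ) (hc : ∀ r, ‖c r‖ ≤ 1) {u : ℝ} (hu : 0 ≤ u) :
    (phaseMeasure (ZMod n)).real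
      {θ | u ≤ ‖∑ r, c r * phase (θ (r + k)) * conj (phase (θ r))‖} ≤
      4 * Real.exp (-(u ^ 2 / (4 * n))) := by
  set s : Finset (ZMod n) := Finset.univ.filter fun r => r.val + k.val < n with hs
  set t : Finset (ZMod n) := Finset.univ.filter fun r => ¬ r.val + k.val < n with ht
  have hs0 : s.Nonempty := ⟨0, by simp [hs, ZMod.val_lt k]⟩
  have ht0 : t.Nonempty := ⟨-k, by
    have : NeZero k := ⟨hk⟩
    have := ZMod.val_lt k
    simp only [ht, Finset.mem_filter, Finset.mem_univ, true_and, ZMod.val_neg_of_ne_zero]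
    omega⟩
  have hst : (s.card : ℝ) + t.card = n := by
    have := Finset.card_filter_add_card_filter_not (s := (Finset.univ : Finset (ZMod n)))
      (fun r => r.val + k.val < n)
    rw [Finset.card_univ, ZMod.card] at this
    exact_mod_cast this
  have ha : (0 : ℝ) < s.card := by exact_mod_cast hs0.card_pos
  have hb : (0 : ℝ) < t.card := by exact_mod_cast ht0.card_pos
  set x := Real.sqrt s.card with hx
  set y := Real.sqrt t.card with hy
  have hx0 : 0 < x := Real.sqrt_pos.mpr ha
  have hy0 : 0 < y := Real.sqrt_pos.mpr hb
  have hx2 : x ^ 2 = s.card := Real.sq_sqrt ha.le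
  have hy2 : y ^ 2 = t.card := Real.sq_sqrt hb.le
  have h1 := measureReal_le_norm_autocorrelation_noWrap hk c hc
    (u := u * (x / (x + y))) (by positivity) s (by simp [hs]) hs0
  have h2 := measureReal_le_norm_autocorrelation_wrap (k := k) c hc
    (u := u * (y / (x + y))) (by positivity) t (by simp [ht]) ht0
  have hexp : ∀ z : ℝ, 0 < z →
      Real.exp (-((u * (z / (x + y))) ^ 2 / (2 * z ^ 2))) ≤ Real.exp (-(u ^ 2 / (4 * n))) := by
    intro z hz
    refine Real.exp_le_exp.mpr (neg_le_neg ?_)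
    rw [show (u * (z / (x + y))) ^ 2 / (2 * z ^ 2) = u ^ 2 / (2 * (x + y) ^ 2) by field_simp]
    refine div_le_div_of_nonneg_left (sq_nonneg u) (by positivity) ?_
    rw [← hst, ← hx2, ← hy2]
    nlinarith [sq_nonneg (x - y)]
  rw [← hx2] at h1
  rw [← hy2] at h2
  have hsub : {θ : ZMod n → AddCircle (2 * Real.pi) |
        u ≤ ‖∑ r, c r * phase (θ (r + k)) * conj (phase (θ r))‖} ⊆
      {θ | u * (x / (x + y)) ≤ ‖∑ r ∈ s, c r * phase (θ (r + k)) * conj (phase (θ r))‖} ∪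
      {θ | u * (y / (x + y)) ≤ ‖∑ r ∈ t, c r * phase (θ (r + k)) * conj (phase (θ r))‖} := by
    intro θ hθ
    have hθ' : u ≤ ‖∑ r, c r * phase (θ (r + k)) * conj (phase (θ r))‖ := hθ
    rw [← Finset.sum_filter_add_sum_filter_not Finset.univ (fun r => r.val + k.val < n)] at hθ'
    by_contra hcon
    simp only [Set.mem_union, Set.mem_ofPred_eq, not_or, not_le] at hcon
    have h3 := norm_add_le (∑ r ∈ s, c r * phase (θ (r + k)) * conj (phase (θ r)))
      (∑ r ∈ t, c r * phase (θ (r + k)) * conj (phase (θ r)))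
    have h4 : u * (x / (x + y)) + u * (y / (x + y)) = u := by field_simp
    linarith [hcon.1, hcon.2]
  have h5 := (measureReal_mono (μ := phaseMeasure (ZMod n)) hsub).trans (measureReal_union_le _ _)
  linarith [hexp x hx0, hexp y hy0]

/-! ### Trace inequalities for powers of Hermitian matrices -/

section TraceInequalities

open scoped ComplexOrder

variable {ι : Type*} [Fintype ι] [DecidableEq ι]

lemma exists_unitary_pow_eq {H : Matrix ι ι ℂ} (hH : H.IsHermitian) :
    ∃ (V : Matrix ι ι ℂ) (l : ι → ℝ), Vᴴ * V = 1 ∧ V * Vᴴ = 1 ∧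
      ∀ k : ℕ, H ^ k = V * Matrix.diagonal (fun i => ((l i ^ k : ℝ) : ℂ)) * Vᴴ := by
  refine ⟨hH.eigenvectorUnitary, hH.eigenvalues, ?_, ?_, fun k => ?_⟩
  · exact Unitary.coe_star_mul_self hH.eigenvectorUnitary
  · exact Unitary.coe_mul_star_self hH.eigenvectorUnitary
  · have h := hH.spectral_theorem
    have h2 : H ^ k = Unitary.conjStarAlgAut ℂ _ hH.eigenvectorUnitary
        (Matrix.diagonal (RCLike.ofReal ∘ hH.eigenvalues) ^ k) := by
      rw [map_pow, ← h]
    rw [h2, Unitary.conjStarAlgAut_apply, Matrix.diagonal_pow]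
    congr 3
    ext i
    simp

lemma trace_mul_diagonal_mul_mul_diagonal (X Y : Matrix ι ι ℂ) (a b : ι → ℂ) :
    (X * Matrix.diagonal a * Y * Matrix.diagonal b).trace =
      ∑ i, ∑ j, X i j * Y j i * (a j * b i) := by
  simp only [Matrix.trace, Matrix.diag_apply, Matrix.mul_diagonal]
  refine Finset.sum_congr rfl fun i _ => ?_
  rw [Matrix.mul_apply, Finset.sum_mul]
  refine Finset.sum_congr rfl fun j _ => ?_
  rw [Matrix.mul_diagonal]
  ring

lemma re_trace_mul_conjTranspose_mul_pow_nonneg {H : Matrix ι ι ℂ} (hH : H.IsHermitian)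
    (X : Matrix ι ι ℂ) (s : ℕ) : 0 ≤ (X * Xᴴ * H ^ (2 * s)).trace.re := by
  have h : (X * Xᴴ * H ^ (2 * s)).trace = ((H ^ s * X) * (H ^ s * X)ᴴ).trace := by
    rw [Matrix.conjTranspose_mul, (hH.pow s).eq, two_mul, pow_add, ← mul_assoc,
      Matrix.trace_mul_comm]
    simp only [mul_assoc]
  rw [h]
  exact (Complex.nonneg_iff.mp (Matrix.posSemidef_self_mul_conjTranspose _).trace_nonneg).1

lemma re_trace_pow_nonneg {H : Matrix ι ι ℂ} (hH : H.IsHermitian) (s : ℕ) :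
    0 ≤ (H ^ (2 * s)).trace.re := by
  simpa using re_trace_mul_conjTranspose_mul_pow_nonneg hH 1 s

/-- The matrix form of `a ≤ 1/4 + a²`. -/
lemma re_trace_mul_pow_le {A H : Matrix ι ι ℂ} (hA : A.IsHermitian) (hH : H.IsHermitian) (s : ℕ) :
    (A * H ^ (2 * s)).trace.re ≤
      1 / 4 * (H ^ (2 * s)).trace.re + (A ^ 2 * H ^ (2 * s)).trace.re := by
  have h := re_trace_mul_conjTranspose_mul_pow_nonneg hH (A - (1 / 2 : ℂ) • 1) s
  have h2 : (A - (1 / 2 : ℂ) • (1 : Matrix ι ι ℂ)) * (A - (1 / 2 : ℂ) • (1 : Matrix ι ι ℂ))ᴴ =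
      A ^ 2 - A + (1 / 4 : ℂ) • 1 := by
    have h3 : (1 / 2 : ℂ) • A + (1 / 2 : ℂ) • A = A := by rw [← add_smul]; norm_num
    have h4 : star (1 / 2 : ℂ) = 1 / 2 := by simp
    have h5 : (1 / 2 : ℂ) * (1 / 2) = 1 / 4 := by norm_num
    rw [Matrix.conjTranspose_sub, hA.eq, Matrix.conjTranspose_smul, Matrix.conjTranspose_one, h4,
      sub_mul, mul_sub, mul_sub, Matrix.smul_mul, Matrix.smul_mul, Matrix.mul_smul,
      Matrix.mul_smul, one_mul, mul_one, one_mul, smul_smul, h5, sq]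
    have h6 : A * A - (1 / 2 : ℂ) • A - ((1 / 2 : ℂ) • A - (1 / 4 : ℂ) • 1) =
        A * A - ((1 / 2 : ℂ) • A + (1 / 2 : ℂ) • A) + (1 / 4 : ℂ) • 1 := by abel
    rw [h6, h3]
  rw [h2, add_mul, sub_mul, Matrix.trace_add, Matrix.trace_sub, Matrix.smul_mul, one_mul,
    Matrix.trace_smul] at h
  simp only [Complex.add_re, Complex.sub_re, smul_eq_mul, Complex.mul_re] at h
  norm_num at h
  linarith

/-- The operator inequality `(i (U - U*))² ≤ 2 (U U* + U* U)`, tested against `H ^ (2 s)`. -/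
lemma re_trace_sq_mul_pow_le {H : Matrix ι ι ℂ} (hH : H.IsHermitian) (U : Matrix ι ι ℂ) (s : ℕ) :
    ((Complex.I • (U - Uᴴ)) * (Complex.I • (U - Uᴴ)) * H ^ (2 * s)).trace.re ≤
      2 * ((U * Uᴴ * H ^ (2 * s)).trace.re + (Uᴴ * U * H ^ (2 * s)).trace.re) := by
  have h := re_trace_mul_conjTranspose_mul_pow_nonneg hH (U + Uᴴ) s
  have h2 : (U + Uᴴ) * (U + Uᴴ)ᴴ = U * Uᴴ + Uᴴ * U + (U * Uᴴ + Uᴴ * U) -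
      (Complex.I • (U - Uᴴ)) * (Complex.I • (U - Uᴴ)) := by
    rw [Matrix.conjTranspose_add, Matrix.conjTranspose_conjTranspose, Matrix.smul_mul,
      Matrix.mul_smul, smul_smul, Complex.I_mul_I, neg_one_smul]
    noncomm_ring
  rw [h2, sub_mul, add_mul, add_mul, Matrix.trace_sub, Matrix.trace_add, Matrix.trace_add,
    Complex.sub_re, Complex.add_re, Complex.add_re] at h
  linarith

/-- Odd powers are monotone, even powers are monotone in the absolute value, and both exponents have
the same parity. -/
lemma sub_pow_mul_sub_pow_nonneg (x y : ℝ) {j k : ℕ} (h : Even (j + k)) :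
    0 ≤ (x ^ j - y ^ j) * (x ^ k - y ^ k) := by
  rcases Nat.even_or_odd j with hj | hj
  · have hk : Even k := (Nat.even_add.mp h).mp hj
    rw [← hj.pow_abs x, ← hj.pow_abs y, ← hk.pow_abs x, ← hk.pow_abs y]
    rcases le_total |x| |y| with hxy | hxy
    · exact mul_nonneg_of_nonpos_of_nonpos (sub_nonpos.mpr (by gcongr)) (sub_nonpos.mpr (by gcongr))
    · exact mul_nonneg (sub_nonneg.mpr (by gcongr)) (sub_nonneg.mpr (by gcongr))
  · have hk : Odd k := by
      rw [← Nat.not_even_iff_odd] at hj ⊢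
      exact fun hk => hj ((Nat.even_add.mp h).mpr hk)
    rcases le_total x y with hxy | hxy
    · exact mul_nonneg_of_nonpos_of_nonpos (sub_nonpos.mpr (hj.strictMono_pow.monotone hxy))
        (sub_nonpos.mpr (hk.strictMono_pow.monotone hxy))
    · exact mul_nonneg (sub_nonneg.mpr (hj.strictMono_pow.monotone hxy))
        (sub_nonneg.mpr (hk.strictMono_pow.monotone hxy))

/-- A mean value inequality for traces: powers of `H` interposed between two factors `D` may be
collected on one side. In an eigenbasis of `H` this is
`x ^ j y ^ (p - j) + x ^ (p - j) y ^ j ≤ x ^ p + y ^ p` for even `p`. -/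
lemma sum_re_trace_mul_pow_mul_mul_pow_le {D H : Matrix ι ι ℂ} (hD : D.IsHermitian)
    (hH : H.IsHermitian) (s : ℕ) :
    ∑ j ∈ Finset.range (2 * s + 1), (D * H ^ j * D * H ^ (2 * s - j)).trace.re ≤
      (2 * s + 1) * (D * D * H ^ (2 * s)).trace.re := by
  obtain ⟨V, l, -, hV, hpow⟩ := exists_unitary_pow_eq hH
  set W := Vᴴ * D * V with hW
  have hWh : W.IsHermitian := Matrix.isHermitian_conjTranspose_mul_mul V hD
  have key : ∀ j k : ℕ, (D * H ^ j * D * H ^ k).trace.re =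
      ∑ a, ∑ b, ‖W a b‖ ^ 2 * (l b ^ j * l a ^ k) := by
    intro j k
    have h1 : (D * H ^ j * D * H ^ k).trace =
        (W * Matrix.diagonal (fun i => ((l i ^ j : ℝ) : ℂ)) * W *
          Matrix.diagonal (fun i => ((l i ^ k : ℝ) : ℂ))).trace := by
      rw [hpow j, hpow k, ← mul_assoc (D * _ * D), Matrix.trace_mul_comm]
      simp only [hW, mul_assoc]
    rw [h1, trace_mul_diagonal_mul_mul_diagonal, Complex.re_sum]
    refine Finset.sum_congr rfl fun a _ => ?_
    rw [Complex.re_sum]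
    refine Finset.sum_congr rfl fun b _ => ?_
    rw [← hWh.apply b a, Complex.star_def, Complex.mul_conj']
    norm_cast
  have hD2 : (D * D * H ^ (2 * s)).trace.re = ∑ a, ∑ b, ‖W a b‖ ^ 2 * l a ^ (2 * s) := by
    have := key 0 (2 * s)
    simpa using this
  have hsymm : ∀ a b, ‖W a b‖ = ‖W b a‖ := fun a b => by
    rw [← hWh.apply a b, norm_star]
  have hD3 : (D * D * H ^ (2 * s)).trace.re = ∑ a, ∑ b, ‖W a b‖ ^ 2 * l b ^ (2 * s) := by
    rw [hD2, Finset.sum_comm]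
    refine Finset.sum_congr rfl fun a _ => Finset.sum_congr rfl fun b _ => ?_
    rw [hsymm]
  set F : ℕ → ℝ := fun j => (D * H ^ j * D * H ^ (2 * s - j)).trace.re with hF
  have hpair : ∀ j ∈ Finset.range (2 * s + 1),
      F j + F (2 * s + 1 - 1 - j) ≤ 2 * (D * D * H ^ (2 * s)).trace.re := by
    intro j hj
    have hj' : j ≤ 2 * s := Nat.lt_succ_iff.mp (Finset.mem_range.mp hj)
    have hsub : 2 * s - (2 * s + 1 - 1 - j) = j := by omega
    have hT : 2 * (D * D * H ^ (2 * s)).trace.re =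
        ∑ a, ∑ b, ‖W a b‖ ^ 2 * l a ^ (2 * s) + ∑ a, ∑ b, ‖W a b‖ ^ 2 * l b ^ (2 * s) := by
      linarith
    have hsub' : 2 * s + 1 - 1 - j = 2 * s - j := by omega
    rw [hT]
    simp only [hF, hsub, key]
    rw [hsub', ← Finset.sum_add_distrib, ← Finset.sum_add_distrib]
    refine Finset.sum_le_sum fun a _ => ?_
    rw [← Finset.sum_add_distrib, ← Finset.sum_add_distrib]
    refine Finset.sum_le_sum fun b _ => ?_
    rw [← mul_add, ← mul_add]
    refine mul_le_mul_of_nonneg_left ?_ (sq_nonneg _)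
    have h := sub_pow_mul_sub_pow_nonneg (l a) (l b) (j := j) (k := 2 * s - j)
      (by rw [Nat.add_sub_cancel' hj']; exact even_two_mul s)
    have ha : l a ^ (2 * s) = l a ^ j * l a ^ (2 * s - j) := by
      rw [← pow_add, Nat.add_sub_cancel' hj']
    have hb : l b ^ (2 * s) = l b ^ j * l b ^ (2 * s - j) := by
      rw [← pow_add, Nat.add_sub_cancel' hj']
    rw [ha, hb]
    nlinarith
  have hsum := Finset.sum_le_sum hpair
  rw [Finset.sum_add_distrib, Finset.sum_range_reflect F, Finset.sum_const, Finset.card_range,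
    nsmul_eq_mul] at hsum
  push_cast at hsum
  linarith

/-- Young's inequality `a b ^ s ≤ a ^ (s + 1) / (s + 1) + s b ^ (s + 1) / (s + 1)`. -/
lemma succ_mul_mul_pow_le {a b : ℝ} (ha : 0 ≤ a) (hb : 0 ≤ b) (s : ℕ) :
    (s + 1) * (a * b ^ s) ≤ a ^ (s + 1) + s * b ^ (s + 1) := by
  induction s with
  | zero => simp
  | succ s ih =>
    have h1 : 0 ≤ (a - b) * (a ^ (s + 1) - b ^ (s + 1)) := by
      rcases le_total a b with h | h
      · exact mul_nonneg_of_nonpos_of_nonpos (sub_nonpos.mpr h) (sub_nonpos.mpr (by gcongr))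
      · exact mul_nonneg (sub_nonneg.mpr h) (sub_nonneg.mpr (by gcongr))
    have h2 := mul_le_mul_of_nonneg_right ih hb
    push_cast
    ring_nf at h1 h2 ⊢
    linarith

lemma sum_norm_sq_unitary_row {W : Matrix ι ι ℂ} (hW : W * Wᴴ = 1) (i : ι) :
    ∑ j, ‖W i j‖ ^ 2 = 1 := by
  have h := congrFun (congrFun hW i) i
  rw [Matrix.mul_apply, Matrix.one_apply_eq] at h
  simp only [Matrix.conjTranspose_apply, Complex.star_def, Complex.mul_conj'] at h
  exact_mod_cast h

lemma re_trace_pow_eq {H V : Matrix ι ι ℂ} {l : ι → ℝ} (hV : Vᴴ * V = 1)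
    {k : ℕ} (hpow : H ^ k = V * Matrix.diagonal (fun i => ((l i ^ k : ℝ) : ℂ)) * Vᴴ) :
    (H ^ k).trace.re = ∑ i, l i ^ k := by
  rw [hpow, mul_assoc, Matrix.trace_mul_comm, mul_assoc, hV, mul_one, Matrix.trace_diagonal,
    Complex.re_sum]
  simp only [Complex.ofReal_re]

/-- Young's inequality for the trace. -/
lemma re_trace_sq_mul_pow_le_young {A B : Matrix ι ι ℂ} (hA : A.IsHermitian) (hB : B.IsHermitian)
    (s : ℕ) :
    (s + 1) * (A ^ 2 * B ^ (2 * s)).trace.re ≤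
      (A ^ (2 * (s + 1))).trace.re + s * (B ^ (2 * (s + 1))).trace.re := by
  obtain ⟨V, l, hV1, hV2, hpowA⟩ := exists_unitary_pow_eq hA
  obtain ⟨V', l', hV1', hV2', hpowB⟩ := exists_unitary_pow_eq hB
  set W := V'ᴴ * V with hW
  have hWr : W * Wᴴ = 1 := by
    rw [hW, Matrix.conjTranspose_mul, Matrix.conjTranspose_conjTranspose, mul_assoc,
      ← mul_assoc V, hV2, one_mul, hV1']
  have hWc : Wᴴ * Wᴴᴴ = 1 := by
    rw [Matrix.conjTranspose_conjTranspose, hW, Matrix.conjTranspose_mul,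
      Matrix.conjTranspose_conjTranspose, mul_assoc, ← mul_assoc V', hV2', one_mul, hV1]
  have hr := sum_norm_sq_unitary_row hWr
  have hc : ∀ j, ∑ i, ‖W i j‖ ^ 2 = 1 := by
    intro j
    simpa using sum_norm_sq_unitary_row hWc j
  have key : (A ^ 2 * B ^ (2 * s)).trace.re =
      ∑ i, ∑ j, ‖W i j‖ ^ 2 * (l j ^ 2 * l' i ^ (2 * s)) := by
    have h1 : (A ^ 2 * B ^ (2 * s)).trace =
        (W * Matrix.diagonal (fun i => ((l i ^ 2 : ℝ) : ℂ)) * Wᴴ *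
          Matrix.diagonal (fun i => ((l' i ^ (2 * s) : ℝ) : ℂ))).trace := by
      rw [hpowA 2, hpowB (2 * s), ← mul_assoc, Matrix.trace_mul_comm, hW,
        Matrix.conjTranspose_mul, Matrix.conjTranspose_conjTranspose]
      simp only [mul_assoc]
    rw [h1, trace_mul_diagonal_mul_mul_diagonal, Complex.re_sum]
    refine Finset.sum_congr rfl fun a _ => ?_
    rw [Complex.re_sum]
    refine Finset.sum_congr rfl fun b _ => ?_
    rw [Matrix.conjTranspose_apply, Complex.star_def, Complex.mul_conj']
    norm_cast
  rw [key, re_trace_pow_eq hV1 (hpowA _), re_trace_pow_eq hV1' (hpowB _)]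
  have hAs : ∑ j, l j ^ (2 * (s + 1)) = ∑ i, ∑ j, ‖W i j‖ ^ 2 * l j ^ (2 * (s + 1)) := by
    rw [Finset.sum_comm]
    refine Finset.sum_congr rfl fun j _ => ?_
    rw [← Finset.sum_mul, hc, one_mul]
  have hBs : ∑ i, l' i ^ (2 * (s + 1)) = ∑ i, ∑ j, ‖W i j‖ ^ 2 * l' i ^ (2 * (s + 1)) := by
    refine Finset.sum_congr rfl fun i _ => ?_
    rw [← Finset.sum_mul, hr, one_mul]
  rw [hAs, hBs, Finset.mul_sum, Finset.mul_sum, ← Finset.sum_add_distrib]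
  refine Finset.sum_le_sum fun i _ => ?_
  rw [Finset.mul_sum, Finset.mul_sum, ← Finset.sum_add_distrib]
  refine Finset.sum_le_sum fun j _ => ?_
  have h := mul_le_mul_of_nonneg_left
    (succ_mul_mul_pow_le (sq_nonneg (l j)) (sq_nonneg (l' i)) s) (sq_nonneg ‖W i j‖)
  simp only [← pow_mul] at h
  linarith

/-- If the trace of `H ^ (2 m)` is small then `‖H‖ < 1/2`, so that `1 + H` is bounded below by
`1/2`. -/
lemma sum_norm_sq_le_of_trace_pow_lt {H : Matrix ι ι ℂ} (hH : H.IsHermitian) {m : ℕ}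
    (h : (H ^ (2 * m)).trace.re < (1 / 4) ^ m) (v : ι → ℂ) :
    ∑ i, ‖v i‖ ^ 2 ≤ 4 * ∑ i, ‖((1 + H) *ᵥ v) i‖ ^ 2 := by
  obtain ⟨V, l, hV1, hV2, hpow⟩ := exists_unitary_pow_eq hH
  rw [re_trace_pow_eq hV1 (hpow _)] at h
  have hl : ∀ i, |l i| ≤ 1 / 2 := by
    intro i
    have h1 : l i ^ (2 * m) ≤ ∑ i, l i ^ (2 * m) :=
      Finset.single_le_sum (f := fun i => l i ^ (2 * m))
        (fun i _ => (even_two_mul m).pow_nonneg _) (Finset.mem_univ i)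
    by_contra hcon
    have h2 : (1 / 2 : ℝ) ^ (2 * m) ≤ |l i| ^ (2 * m) := by
      have := (not_le.mp hcon).le
      gcongr
    rw [(even_two_mul m).pow_abs, pow_mul] at h2
    norm_num at h2 h
    linarith
  have hnorm : ∀ w : ι → ℂ, ∑ i, ‖w i‖ ^ 2 = (star w ⬝ᵥ w).re := by
    intro w
    rw [dotProduct, Complex.re_sum]
    refine Finset.sum_congr rfl fun i _ => ?_
    rw [Pi.star_apply, Complex.star_def, Complex.conj_mul']
    norm_cast
  have hunit : ∀ (Q : Matrix ι ι ℂ), Qᴴ * Q = 1 → ∀ w : ι → ℂ,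
      ∑ i, ‖(Q *ᵥ w) i‖ ^ 2 = ∑ i, ‖w i‖ ^ 2 := by
    intro Q hQ w
    rw [hnorm, hnorm, Matrix.star_mulVec, Matrix.dotProduct_mulVec, Matrix.vecMul_vecMul, hQ,
      Matrix.vecMul_one]
  have hVstar : Vᴴᴴ * Vᴴ = 1 := by rw [Matrix.conjTranspose_conjTranspose, hV2]
  set w := Vᴴ *ᵥ v with hw
  have h1 : (1 + H) *ᵥ v = V *ᵥ (fun i => ((1 + l i : ℝ) : ℂ) * w i) := by
    have hH1 := hpow 1
    simp only [pow_one] at hH1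
    have h2 : (fun i => ((1 + l i : ℝ) : ℂ) * w i) =
        w + Matrix.diagonal (fun i => ((l i : ℝ) : ℂ)) *ᵥ w := by
      ext i
      rw [Pi.add_apply, Matrix.mulVec_diagonal]
      push_cast; ring
    rw [h2, Matrix.mulVec_add, hw, Matrix.mulVec_mulVec, Matrix.mulVec_mulVec,
      Matrix.mulVec_mulVec, hV2, ← hH1, Matrix.add_mulVec]
  rw [h1, hunit V hV1, ← hunit Vᴴ hVstar v, Finset.mul_sum]
  refine Finset.sum_le_sum fun i _ => ?_
  rw [norm_mul, mul_pow, Complex.norm_real, Real.norm_eq_abs, sq_abs, ← hw]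
  have h3 := abs_le.mp (hl i)
  nlinarith [sq_nonneg ‖w i‖, h3.1, h3.2, mul_nonneg (sq_nonneg ‖w i‖)
    (by nlinarith [h3.1] : (0 : ℝ) ≤ 4 * (1 + l i) ^ 2 - 1)]

end TraceInequalities

/-! ### The Gabor system restricted to a set of time-frequency shifts -/

/-- The factor `1 / √n` that normalizes the window. -/
noncomputable def windowScale (n : ℕ) : ℂ := 1 / (Real.sqrt n : ℂ)

lemma windowScale_mul_self {n : ℕ} : windowScale n * windowScale n = 1 / n := by
  rw [windowScale, div_mul_div_comm, one_mul, ← Complex.ofReal_mul,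
    Real.mul_self_sqrt (Nat.cast_nonneg n), Complex.ofReal_natCast]

lemma conj_windowScale {n : ℕ} : conj (windowScale n) = windowScale n := by
  rw [windowScale, map_div₀, map_one, Complex.conj_ofReal]

section Gabor

variable {n : ℕ} [NeZero n]

lemma norm_stdAddChar (a : ZMod n) : ‖ZMod.stdAddChar a‖ = 1 := by
  rw [ZMod.stdAddChar_apply, Circle.norm_coe]

lemma conj_stdAddChar (a : ZMod n) : conj (ZMod.stdAddChar a) = ZMod.stdAddChar (-a) := by
  rw [ZMod.stdAddChar_apply, ZMod.stdAddChar_apply, ← Circle.coe_inv_eq_conj,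
    AddChar.map_neg_eq_inv]

lemma sum_stdAddChar_mul (a : ZMod n) :
    ∑ p : ZMod n, ZMod.stdAddChar (a * p) = if a = 0 then (n : ℂ) else 0 := by
  have h := AddChar.sum_mulShift a (ZMod.isPrimitive_stdAddChar n)
  simp only [ZMod.card] at h
  simp_rw [mul_comm a]
  rw [h]
  split_ifs <;> simp

lemma gaborMatrix_normalizedWindow_apply (ε : ZMod n → ℂ) (p : ZMod n) (lam : ZMod n × ZMod n) :
    gaborMatrix (normalizedWindow ε) p lam =
      windowScale n * ZMod.stdAddChar (lam.2 * p) * ε (lam.1 + p) := by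
  have h : Complex.exp (2 * Real.pi * Complex.I * (lam.2.val : ℂ) * (p.val : ℂ) / (n : ℂ)) =
      ZMod.stdAddChar (lam.2 * p) := by
    have h2 := ZMod.stdAddChar_coe (N := n) ((lam.2.val * p.val : ℕ) : ℤ)
    have h3 : (((lam.2.val * p.val : ℕ) : ℤ) : ZMod n) = lam.2 * p := by
      push_cast
      rw [ZMod.natCast_zmod_val, ZMod.natCast_zmod_val]
    rw [h3] at h2
    rw [h2]
    push_cast
    congr 1
    ring
  change Complex.exp _ * (1 / (Real.sqrt n : ℂ) * ε (lam.1 + p)) = _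
  rw [h, windowScale]
  ring

/-- The columns of the Gabor synthesis matrix with indices in `Λ`. -/
noncomputable def gaborSubmatrix (Λ : Finset (ZMod n × ZMod n)) (ε : ZMod n → ℂ) :
    Matrix (ZMod n) Λ ℂ :=
  Matrix.of fun p lam => windowScale n * ZMod.stdAddChar (lam.1.2 * p) * ε (lam.1.1 + p)

/-- The coefficient of `ε_q` in `gaborSubmatrix Λ ε`. -/
noncomputable def gaborCoeff (Λ : Finset (ZMod n × ZMod n)) (q : ZMod n) :
    Matrix (ZMod n) Λ ℂ :=
  Matrix.of fun p lam =>
    if lam.1.1 + p = q then windowScale n * ZMod.stdAddChar (lam.1.2 * p) else 0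

/-- The deviation `Ψ* Ψ - 1` of the Gram matrix of the columns indexed by `Λ` from the
identity. -/
noncomputable def gramDefect (Λ : Finset (ZMod n × ZMod n)) (ε : ZMod n → ℂ) : Matrix Λ Λ ℂ :=
  (gaborSubmatrix Λ ε)ᴴ * gaborSubmatrix Λ ε - 1

variable (Λ : Finset (ZMod n × ZMod n))

lemma gaborSubmatrix_eq_sum (ε : ZMod n → ℂ) :
    gaborSubmatrix Λ ε = ∑ q, ε q • gaborCoeff Λ q := by
  ext p lam
  rw [Matrix.sum_apply]
  simp only [Matrix.smul_apply, gaborCoeff, gaborSubmatrix, Matrix.of_apply, smul_eq_mul, mul_ite,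
    mul_zero, Finset.sum_ite_eq, Finset.mem_univ, if_true]
  ring

lemma isHermitian_gramDefect (ε : ZMod n → ℂ) : (gramDefect Λ ε).IsHermitian :=
  (Matrix.isHermitian_conjTranspose_mul_self _).sub Matrix.isHermitian_one

lemma one_add_gramDefect (ε : ZMod n → ℂ) :
    1 + gramDefect Λ ε = (gaborSubmatrix Λ ε)ᴴ * gaborSubmatrix Λ ε := by
  rw [gramDefect]; abel

lemma sum_conjTranspose_gaborCoeff_mul_self :
    ∑ q, (gaborCoeff Λ q)ᴴ * gaborCoeff Λ q = 1 := by
  ext lam lam'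
  have hn : (n : ℂ) ≠ 0 := Nat.cast_ne_zero.mpr (NeZero.ne n)
  rw [Matrix.sum_apply]
  simp only [Matrix.mul_apply, Matrix.conjTranspose_apply, gaborCoeff, Matrix.of_apply,
    Complex.star_def]
  rw [Finset.sum_comm]
  have h : ∀ p : ZMod n, (∑ q, conj (if lam.1.1 + p = q then
        windowScale n * ZMod.stdAddChar (lam.1.2 * p) else 0) *
        (if lam'.1.1 + p = q then windowScale n * ZMod.stdAddChar (lam'.1.2 * p) else 0)) =
      if lam.1.1 = lam'.1.1 then
        1 / n * ZMod.stdAddChar ((lam'.1.2 - lam.1.2) * p) else 0 := by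
    intro p
    rw [Finset.sum_eq_single (lam.1.1 + p)]
    · by_cases hk : lam.1.1 = lam'.1.1
      · rw [if_pos rfl, if_pos (by rw [hk]), if_pos hk, map_mul, conj_windowScale, conj_stdAddChar,
          mul_mul_mul_comm, windowScale_mul_self, ← AddChar.map_add_eq_mul]
        congr 2
        ring
      · rw [if_neg hk, if_neg (fun h => hk (add_right_cancel h).symm), mul_zero]
    · intro q _ hq
      rw [if_neg (Ne.symm hq), map_zero, zero_mul]
    · simp
  simp_rw [h]
  by_cases hk : lam.1.1 = lam'.1.1
  · simp only [hk, if_true]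
    rw [← Finset.mul_sum, sum_stdAddChar_mul]
    by_cases hl : lam.1.2 = lam'.1.2
    · have hll : lam = lam' := Subtype.ext (Prod.ext hk hl)
      rw [if_pos (by rw [hl, sub_self]), hll, Matrix.one_apply_eq]
      field_simp
    · have hll : lam ≠ lam' := fun h => hl (by rw [h])
      rw [if_neg (fun h => hl (sub_eq_zero.mp h).symm), Matrix.one_apply_ne hll, mul_zero]
  · have hll : lam ≠ lam' := fun h => hk (by rw [h])
    simp only [hk, if_false, Finset.sum_const_zero]
    rw [Matrix.one_apply_ne hll]

lemma sum_gaborCoeff_mul_conjTranspose :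
    ∑ q, gaborCoeff Λ q * (gaborCoeff Λ q)ᴴ = ((Λ.card : ℂ) / n) • 1 := by
  ext p p'
  rw [Matrix.sum_apply]
  simp only [Matrix.mul_apply, Matrix.conjTranspose_apply, gaborCoeff, Matrix.of_apply,
    Complex.star_def]
  rw [Finset.sum_comm]
  have h : ∀ lam : Λ, (∑ q, (if lam.1.1 + p = q then
        windowScale n * ZMod.stdAddChar (lam.1.2 * p) else 0) *
        conj (if lam.1.1 + p' = q then windowScale n * ZMod.stdAddChar (lam.1.2 * p') else 0)) =
      if p = p' then (1 / n : ℂ) else 0 := by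
    intro lam
    rw [Finset.sum_eq_single (lam.1.1 + p)]
    · by_cases hp : p = p'
      · rw [if_pos rfl, if_pos (by rw [hp]), if_pos hp, map_mul (starRingEnd ℂ),
          conj_windowScale, conj_stdAddChar,
          mul_mul_mul_comm, windowScale_mul_self, ← AddChar.map_add_eq_mul, hp, add_neg_cancel,
          AddChar.map_zero_eq_one, mul_one]
      · rw [if_neg hp, if_neg (fun h => hp (add_left_cancel h).symm), map_zero, mul_zero]
    · intro q _ hq
      rw [if_neg (Ne.symm hq), zero_mul]
    · simp
  simp_rw [h]
  rw [Finset.sum_const, Finset.card_univ, Fintype.card_coe, Matrix.smul_apply, Matrix.one_apply]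
  split_ifs <;> simp [div_eq_mul_inv]

/-- The unimodular factors which link the Gabor system to the one of the reflected window. -/
noncomputable def reflectionPhase (mu : ZMod n × ZMod n) (lam : Λ) : ℂ :=
  ZMod.stdAddChar (mu.2 * lam.1.1 - mu.1 * lam.1.2 - lam.1.1 * lam.1.2)

/-- Exchanging the roles of time-frequency shift and position turns the matrix
`∑ B_q* Ψ Ψ* B_q` into a combination of unitary conjugates of the transposed Gram matrix belonging
to the reflected window `s ↦ ε_{-s}`. -/
lemma sum_conjTranspose_gaborCoeff_mul_mul (ε : ZMod n → ℂ) :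
    ∑ q, (gaborCoeff Λ q)ᴴ * gaborSubmatrix Λ ε *
        ((gaborSubmatrix Λ ε)ᴴ * gaborCoeff Λ q) =
      (1 / n : ℂ) • ∑ mu : Λ, (Matrix.diagonal (reflectionPhase Λ mu.1))ᴴ *
        (1 + gramDefect Λ fun s => ε (-s))ᵀ * Matrix.diagonal (reflectionPhase Λ mu.1) := by
  ext lam lam'
  have hY : ∀ (q : ZMod n) (mu lam : Λ), ((gaborSubmatrix Λ ε)ᴴ * gaborCoeff Λ q) mu lam =
      1 / n * ZMod.stdAddChar ((lam.1.2 - mu.1.2) * (q - lam.1.1)) *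
        conj (ε (mu.1.1 + q - lam.1.1)) := by
    intro q mu lam
    rw [Matrix.mul_apply, Finset.sum_eq_single (q - lam.1.1)]
    · rw [Matrix.conjTranspose_apply, gaborCoeff, gaborSubmatrix, Matrix.of_apply, Matrix.of_apply,
        if_pos (by ring), Complex.star_def, map_mul, map_mul, conj_windowScale, conj_stdAddChar,
        mul_right_comm, mul_mul_mul_comm, windowScale_mul_self, ← AddChar.map_add_eq_mul]
      congr 3 <;> ring
    · intro p _ hp
      rw [gaborCoeff, Matrix.of_apply, if_neg, mul_zero]
      exact fun h => hp (by rw [← h]; ring)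
    · simp
  have hstar : ∀ q, (gaborCoeff Λ q)ᴴ * gaborSubmatrix Λ ε =
      ((gaborSubmatrix Λ ε)ᴴ * gaborCoeff Λ q)ᴴ := by
    intro q
    rw [Matrix.conjTranspose_mul, Matrix.conjTranspose_conjTranspose]
  rw [Matrix.sum_apply, Matrix.smul_apply, Matrix.sum_apply]
  simp_rw [hstar]
  simp only [Matrix.mul_apply (N := (gaborSubmatrix Λ ε)ᴴ * gaborCoeff Λ _)]
  rw [Finset.sum_comm, smul_eq_mul, Finset.mul_sum]
  refine Finset.sum_congr rfl fun mu _ => ?_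
  rw [Matrix.diagonal_conjTranspose, Matrix.mul_diagonal, Matrix.diagonal_mul, one_add_gramDefect,
    Matrix.transpose_apply, Matrix.mul_apply, Finset.mul_sum, Finset.sum_mul, Finset.mul_sum]
  -- The position `q` on the left corresponds to the position `- q - a` on the right, where `a` is
  -- the time shift of `mu`.
  refine Fintype.sum_equiv ((Equiv.neg (ZMod n)).trans (Equiv.addRight (-mu.1.1))) _ _ fun q => ?_
  have hs : ((Equiv.neg (ZMod n)).trans (Equiv.addRight (-mu.1.1))) q = -q - mu.1.1 := by
    simp [sub_eq_add_neg]
  rw [hs, Matrix.conjTranspose_apply ((gaborSubmatrix Λ ε)ᴴ * gaborCoeff Λ q), hY, hY]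
  simp only [Matrix.conjTranspose_apply, gaborSubmatrix, Matrix.of_apply, Complex.star_def,
    map_mul, map_div₀, map_one, Complex.conj_natCast, conj_stdAddChar, Complex.conj_conj,
    conj_windowScale, Pi.star_apply, reflectionPhase]
  have e1 : -(lam.1.1 + (-q - mu.1.1)) = mu.1.1 + q - lam.1.1 := by ring
  have e2 : -(lam'.1.1 + (-q - mu.1.1)) = mu.1.1 + q - lam'.1.1 := by ring
  rw [e1, e2]
  have hchar : ZMod.stdAddChar (-((lam.1.2 - mu.1.2) * (q - lam.1.1))) *
        ZMod.stdAddChar ((lam'.1.2 - mu.1.2) * (q - lam'.1.1)) =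
      ZMod.stdAddChar (-(mu.1.2 * lam.1.1 - mu.1.1 * lam.1.2 - lam.1.1 * lam.1.2)) *
        ZMod.stdAddChar (-(lam'.1.2 * (-q - mu.1.1))) *
        ZMod.stdAddChar (lam.1.2 * (-q - mu.1.1)) *
        (ZMod.stdAddChar (mu.1.2 * lam'.1.1 - mu.1.1 * lam'.1.2 - lam'.1.1 * lam'.1.2) : ℂ) := by
    simp only [← AddChar.map_add_eq_mul]
    congr 1
    ring
  have hw := windowScale_mul_self (n := n)
  linear_combination (1 / n * (1 / n) * ε (mu.1.1 + q - lam.1.1) *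
    conj (ε (mu.1.1 + q - lam'.1.1))) * hchar -
    (1 / n * ε (mu.1.1 + q - lam.1.1) * conj (ε (mu.1.1 + q - lam'.1.1)) *
      ZMod.stdAddChar (-(mu.1.2 * lam.1.1 - mu.1.1 * lam.1.2 - lam.1.1 * lam.1.2)) *
        ZMod.stdAddChar (-(lam'.1.2 * (-q - mu.1.1))) *
        ZMod.stdAddChar (lam.1.2 * (-q - mu.1.1)) *
        ZMod.stdAddChar (mu.1.2 * lam'.1.1 - mu.1.1 * lam'.1.2 - lam'.1.1 * lam'.1.2)) * hw

end Gabor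

/-! ### Integration by parts for the trace moments of the Gram matrix -/

section EntrywiseDerivative

variable {ι : Type*} [Fintype ι]

lemma hasDerivAt_matrix_mul {F G : ℝ → Matrix ι ι ℂ} {F' G' : Matrix ι ι ℂ} {x : ℝ}
    (hF : ∀ i j, HasDerivAt (fun t => F t i j) (F' i j) x)
    (hG : ∀ i j, HasDerivAt (fun t => G t i j) (G' i j) x) (i j : ι) :
    HasDerivAt (fun t => (F t * G t) i j) ((F' * G x + F x * G') i j) x := by
  simp only [Matrix.mul_apply, Matrix.add_apply, ← Finset.sum_add_distrib]
  exact HasDerivAt.fun_sum fun k _ => (hF i k).mul (hG k j)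

lemma hasDerivAt_matrix_pow [DecidableEq ι] {F : ℝ → Matrix ι ι ℂ} {F' : Matrix ι ι ℂ} {x : ℝ}
    (hF : ∀ i j, HasDerivAt (fun t => F t i j) (F' i j) x) (m : ℕ) (i j : ι) :
    HasDerivAt (fun t => (F t ^ m) i j)
      ((∑ k ∈ Finset.range m, F x ^ k * F' * F x ^ (m - 1 - k)) i j) x := by
  induction m generalizing i j with
  | zero => simpa using hasDerivAt_const x _
  | succ m ih =>
    have h := hasDerivAt_matrix_mul ih hF i j
    simp only [pow_succ]
    convert! h using 1
    have hs : (∑ k ∈ Finset.range m, F x ^ k * F' * F x ^ (m - 1 - k)) * F x =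
        ∑ k ∈ Finset.range m, F x ^ k * F' * F x ^ (m + 1 - 1 - k) := by
      rw [Finset.sum_mul]
      refine Finset.sum_congr rfl fun k hk => ?_
      have hk' : m + 1 - 1 - k = m - 1 - k + 1 := by
        have := Finset.mem_range.mp hk
        omega
      rw [hk', pow_succ, ← mul_assoc]
    rw [Finset.sum_range_succ, hs]
    simp

lemma hasDerivAt_matrix_trace {F : ℝ → Matrix ι ι ℂ} {F' : Matrix ι ι ℂ} {x : ℝ}
    (hF : ∀ i j, HasDerivAt (fun t => F t i j) (F' i j) x) :
    HasDerivAt (fun t => (F t).trace) F'.trace x :=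
  HasDerivAt.fun_sum fun i _ => hF i i

end EntrywiseDerivative

/-- The window `(ε_q)` with independent uniform phases. -/
noncomputable def phaseWindow {n : ℕ} (θ : ZMod n → AddCircle (2 * Real.pi)) : ZMod n → ℂ :=
  fun q => phase (θ q)

lemma continuous_phaseWindow {n : ℕ} :
    Continuous (phaseWindow : (ZMod n → AddCircle (2 * Real.pi)) → ZMod n → ℂ) :=
  continuous_pi fun q => continuous_phase.comp (continuous_apply q)

section Recursion

variable {n : ℕ} [NeZero n] (Λ : Finset (ZMod n × ZMod n))

/-- The matrix `ε_q Ψ* B_q`. -/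
noncomputable def gramCoeff (q : ZMod n) (ε : ZMod n → ℂ) : Matrix Λ Λ ℂ :=
  ε q • ((gaborSubmatrix Λ ε)ᴴ * gaborCoeff Λ q)

/-- The derivative `i (U - U*)` of the Gram matrix with respect to the angle of `ε_q`, where
`U = ε_q Ψ* B_q`. -/
noncomputable def gramDeriv (q : ZMod n) (ε : ZMod n → ℂ) : Matrix Λ Λ ℂ :=
  Complex.I • (gramCoeff Λ q ε - (gramCoeff Λ q ε)ᴴ)

/-- The second derivative of the Gram matrix with respect to the angle of `ε_q`. -/
noncomputable def gramSecondDeriv (q : ZMod n) (ε : ZMod n → ℂ) : Matrix Λ Λ ℂ :=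
  (2 : ℂ) • ((gaborCoeff Λ q)ᴴ * gaborCoeff Λ q) - (gramCoeff Λ q ε + (gramCoeff Λ q ε)ᴴ)

lemma isHermitian_gramDeriv (q : ZMod n) (ε : ZMod n → ℂ) : (gramDeriv Λ q ε).IsHermitian := by
  rw [Matrix.IsHermitian, gramDeriv, Matrix.conjTranspose_smul, Matrix.conjTranspose_sub,
    Matrix.conjTranspose_conjTranspose, Complex.star_def, Complex.conj_I, neg_smul, ← smul_neg,
    neg_sub]

lemma sum_gramCoeff (ε : ZMod n → ℂ) : ∑ q, gramCoeff Λ q ε = 1 + gramDefect Λ ε := by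
  rw [one_add_gramDefect]
  simp only [gramCoeff, ← Matrix.mul_smul]
  rw [← Matrix.mul_sum, ← gaborSubmatrix_eq_sum]

/-- Every off-diagonal entry of the Gram matrix is a sum of products `ε_r conj ε_s`, `r ≠ s`, so
the second derivatives add up to `- 2 H`. -/
lemma sum_gramSecondDeriv (ε : ZMod n → ℂ) :
    ∑ q, gramSecondDeriv Λ q ε = (-2 : ℂ) • gramDefect Λ ε := by
  simp only [gramSecondDeriv]
  rw [Finset.sum_sub_distrib, Finset.sum_add_distrib, ← Finset.smul_sum,
    sum_conjTranspose_gaborCoeff_mul_self, ← Matrix.conjTranspose_sum, sum_gramCoeff,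
    Matrix.conjTranspose_add, Matrix.conjTranspose_one, (isHermitian_gramDefect Λ ε).eq, two_smul,
    neg_smul, two_smul]
  abel

lemma gaborSubmatrix_shift (θ : ZMod n → AddCircle (2 * Real.pi)) (q : ZMod n)
    (x : AddCircle (2 * Real.pi)) :
    gaborSubmatrix Λ (phaseWindow (θ + singleAngle q x)) =
      gaborSubmatrix Λ (phaseWindow θ) + ((phase x - 1) * phase (θ q)) • gaborCoeff Λ q := by
  ext p lam
  rw [Matrix.add_apply, Matrix.smul_apply]
  simp only [gaborSubmatrix, gaborCoeff, Matrix.of_apply, phaseWindow, Pi.add_apply, phase_add,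
    smul_eq_mul]
  by_cases h : lam.1.1 + p = q
  · rw [if_pos h, h, singleAngle_self]; ring
  · rw [if_neg h, singleAngle_of_ne h, phase_zero]; ring

lemma gramDefect_shift (θ : ZMod n → AddCircle (2 * Real.pi)) (q : ZMod n)
    (x : AddCircle (2 * Real.pi)) :
    gramDefect Λ (phaseWindow (θ + singleAngle q x)) =
      gramDefect Λ (phaseWindow θ) + (phase x - 1) • gramCoeff Λ q (phaseWindow θ) +
        (conj (phase x) - 1) • (gramCoeff Λ q (phaseWindow θ))ᴴ +
        (2 - phase x - conj (phase x)) • ((gaborCoeff Λ q)ᴴ * gaborCoeff Λ q) := by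
  have h1 := conj_phase_mul_self x
  have h2 := conj_phase_mul_self (θ q)
  have h3 : conj ((phase x - 1) * phase (θ q)) * ((phase x - 1) * phase (θ q)) =
      2 - phase x - conj (phase x) := by
    rw [map_mul, map_sub, map_one]
    linear_combination (conj (phase x) - 1) * (phase x - 1) * h2 + h1
  rw [gramDefect, gaborSubmatrix_shift, gramDefect, gramCoeff, ← h3, Matrix.conjTranspose_add,
    Matrix.conjTranspose_smul, Matrix.conjTranspose_smul, Matrix.conjTranspose_mul,
    Matrix.conjTranspose_conjTranspose, Complex.star_def]
  simp only [Matrix.add_mul, Matrix.mul_add, Matrix.smul_mul, Matrix.mul_smul, smul_smul,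
    map_mul, map_sub, map_one, phaseWindow]
  module

lemma gramCoeff_shift (θ : ZMod n → AddCircle (2 * Real.pi)) (q : ZMod n)
    (x : AddCircle (2 * Real.pi)) :
    gramCoeff Λ q (phaseWindow (θ + singleAngle q x)) =
      phase x • gramCoeff Λ q (phaseWindow θ) +
        (1 - phase x) • ((gaborCoeff Λ q)ᴴ * gaborCoeff Λ q) := by
  have h1 := conj_phase_mul_self x
  have h2 := conj_phase_mul_self (θ q)
  have h3 : phase (θ q) * phase x * conj ((phase x - 1) * phase (θ q)) = 1 - phase x := by
    rw [map_mul, map_sub, map_one]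
    linear_combination (conj (phase x) - 1) * phase x * h2 + h1
  rw [gramCoeff, gaborSubmatrix_shift, gramCoeff, Matrix.conjTranspose_add,
    Matrix.conjTranspose_smul, Complex.star_def, Matrix.add_mul, smul_add, Matrix.smul_mul, smul_smul]
  simp only [phaseWindow, Pi.add_apply, singleAngle_self, phase_add]
  rw [h3, smul_smul, mul_comm (phase (θ q))]

lemma hasDerivAt_phase_zero :
    HasDerivAt (fun t : ℝ => phase (t : AddCircle (2 * Real.pi))) Complex.I 0 := by
  simpa [phase_zero] using hasDerivAt_phase 0

lemma hasDerivAt_conj_phase_zero :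
    HasDerivAt (fun t : ℝ => conj (phase (t : AddCircle (2 * Real.pi)))) (-Complex.I) 0 := by
  simpa using hasDerivAt_phase_zero.star

lemma hasDerivAt_gramDefect (θ : ZMod n → AddCircle (2 * Real.pi)) (q : ZMod n) (i j : Λ) :
    HasDerivAt (fun t : ℝ => gramDefect Λ (phaseWindow (θ + singleAngle q t)) i j)
      (gramDeriv Λ q (phaseWindow θ) i j) 0 := by
  simp only [gramDefect_shift, gramDeriv, Matrix.add_apply, Matrix.smul_apply, Matrix.sub_apply,
    smul_eq_mul]
  have h := ((((hasDerivAt_const (0 : ℝ) (gramDefect Λ (phaseWindow θ) i j)).fun_add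
    ((hasDerivAt_phase_zero.sub_const 1).mul_const (gramCoeff Λ q (phaseWindow θ) i j))).fun_add
    ((hasDerivAt_conj_phase_zero.sub_const 1).mul_const
      ((gramCoeff Λ q (phaseWindow θ))ᴴ i j))).fun_add
    (((hasDerivAt_phase_zero.const_sub 2).fun_sub hasDerivAt_conj_phase_zero).mul_const
      (((gaborCoeff Λ q)ᴴ * gaborCoeff Λ q) i j)))
  convert! h using 1
  ring

lemma hasDerivAt_gramDeriv (θ : ZMod n → AddCircle (2 * Real.pi)) (q : ZMod n) (i j : Λ) :
    HasDerivAt (fun t : ℝ => gramDeriv Λ q (phaseWindow (θ + singleAngle q t)) i j)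
      (gramSecondDeriv Λ q (phaseWindow θ) i j) 0 := by
  simp only [gramDeriv, gramCoeff_shift, gramSecondDeriv, Matrix.conjTranspose_add,
    Matrix.conjTranspose_smul, Matrix.conjTranspose_mul, Matrix.conjTranspose_conjTranspose,
    Matrix.add_apply, Matrix.smul_apply, Matrix.sub_apply, smul_eq_mul, Complex.star_def,
    map_sub, map_one]
  have h := ((((hasDerivAt_phase_zero.mul_const (gramCoeff Λ q (phaseWindow θ) i j)).fun_add
    ((hasDerivAt_phase_zero.const_sub 1).mul_const
      (((gaborCoeff Λ q)ᴴ * gaborCoeff Λ q) i j))).fun_sub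
    ((hasDerivAt_conj_phase_zero.mul_const ((gramCoeff Λ q (phaseWindow θ))ᴴ i j)).fun_add
      ((hasDerivAt_conj_phase_zero.const_sub 1).mul_const
        (((gaborCoeff Λ q)ᴴ * gaborCoeff Λ q) i j)))).const_mul Complex.I)
  convert! h using 1
  ring_nf
  simp only [Complex.I_sq]
  ring

lemma continuous_gaborSubmatrix : Continuous (gaborSubmatrix Λ) := by
  refine continuous_matrix fun p lam => ?_
  simp only [gaborSubmatrix, Matrix.of_apply]
  fun_prop

lemma continuous_gramDefect : Continuous (gramDefect Λ) :=
  ((continuous_gaborSubmatrix Λ).matrix_conjTranspose.matrix_mul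
    (continuous_gaborSubmatrix Λ)).sub continuous_const

lemma continuous_gramCoeff (q : ZMod n) : Continuous (gramCoeff Λ q) :=
  (continuous_apply q).smul
    ((continuous_gaborSubmatrix Λ).matrix_conjTranspose.matrix_mul continuous_const)

lemma continuous_gramDeriv (q : ZMod n) : Continuous (gramDeriv Λ q) :=
  ((continuous_gramCoeff Λ q).sub (continuous_gramCoeff Λ q).matrix_conjTranspose).const_smul
    Complex.I

lemma continuous_gramSecondDeriv (q : ZMod n) : Continuous (gramSecondDeriv Λ q) :=
  continuous_const.sub
    ((continuous_gramCoeff Λ q).add (continuous_gramCoeff Λ q).matrix_conjTranspose)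

/-- Integration by parts: the angular derivative of `Tr (∂_q H · H ^ (k + 1))` has mean zero. -/
lemma integral_trace_gramSecondDeriv (q : ZMod n) (k : ℕ) :
    ∫ θ, ((gramSecondDeriv Λ q (phaseWindow θ) * gramDefect Λ (phaseWindow θ) ^ (k + 1)).trace +
      ∑ j ∈ Finset.range (k + 1), (gramDeriv Λ q (phaseWindow θ) *
        gramDefect Λ (phaseWindow θ) ^ j * gramDeriv Λ q (phaseWindow θ) *
          gramDefect Λ (phaseWindow θ) ^ (k - j)).trace) ∂phaseMeasure (ZMod n) = 0 := by
  have h1 := (continuous_gramDefect Λ).comp continuous_phaseWindow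
  have h2 := (continuous_gramDeriv Λ q).comp continuous_phaseWindow
  have h3 := (continuous_gramSecondDeriv Λ q).comp continuous_phaseWindow
  simp only [Function.comp_def] at h1 h2 h3
  refine integral_phaseMeasure_deriv_eq_zero q
    (f := fun θ => (gramDeriv Λ q (phaseWindow θ) * gramDefect Λ (phaseWindow θ) ^ (k + 1)).trace)
    ?_ fun θ => ?_
  · exact ((h3.matrix_mul (h1.pow _)).matrix_trace).add (continuous_finsetSum _ fun j _ =>
      (((h2.matrix_mul (h1.pow _)).matrix_mul h2).matrix_mul (h1.pow _)).matrix_trace)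
  · have h := hasDerivAt_matrix_trace (hasDerivAt_matrix_mul (hasDerivAt_gramDeriv Λ θ q)
      (hasDerivAt_matrix_pow (hasDerivAt_gramDefect Λ θ q) (k + 1)))
    convert! h using 1
    rw [AddCircle.coe_zero, singleAngle_zero, add_zero, Matrix.trace_add, Finset.mul_sum,
      Matrix.trace_sum]
    simp only [mul_assoc, Nat.add_sub_cancel]

/-- The trace of a power of the Gram defect, which is real because the defect is Hermitian. -/
noncomputable def gramTrace (k : ℕ) (ε : ZMod n → ℂ) : ℝ := ((gramDefect Λ ε) ^ k).trace.re

lemma continuous_gramTrace (k : ℕ) : Continuous (gramTrace Λ k) :=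
  Complex.continuous_re.comp (((continuous_gramDefect Λ).pow k).matrix_trace)

/-- The result of integrating by parts in every angle and adding up, by `∑_q ∂_q² H = - 2 H`. -/
lemma two_mul_integral_gramTrace (s : ℕ) :
    2 * ∫ θ, gramTrace Λ (2 * (s + 1)) (phaseWindow θ) ∂phaseMeasure (ZMod n) =
      ∫ θ, ∑ q, ∑ j ∈ Finset.range (2 * s + 1), (gramDeriv Λ q (phaseWindow θ) *
        gramDefect Λ (phaseWindow θ) ^ j * gramDeriv Λ q (phaseWindow θ) *
          gramDefect Λ (phaseWindow θ) ^ (2 * s - j)).trace.re ∂phaseMeasure (ZMod n) := by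
  have h1 := (continuous_gramDefect Λ).comp continuous_phaseWindow
  have h2 := fun q => (continuous_gramDeriv Λ q).comp continuous_phaseWindow
  have h3 := fun q => (continuous_gramSecondDeriv Λ q).comp continuous_phaseWindow
  simp only [Function.comp_def] at h1 h2 h3
  have hc1 : ∀ q, Continuous fun θ : ZMod n → AddCircle (2 * Real.pi) =>
      (gramSecondDeriv Λ q (phaseWindow θ) *
        gramDefect Λ (phaseWindow θ) ^ (2 * s + 1)).trace :=
    fun q => ((h3 q).matrix_mul (h1.pow _)).matrix_trace
  have hc2 : ∀ q, Continuous fun θ : ZMod n → AddCircle (2 * Real.pi) =>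
      ∑ j ∈ Finset.range (2 * s + 1), (gramDeriv Λ q (phaseWindow θ) *
        gramDefect Λ (phaseWindow θ) ^ j * gramDeriv Λ q (phaseWindow θ) *
          gramDefect Λ (phaseWindow θ) ^ (2 * s - j)).trace :=
    fun q => continuous_finsetSum _ fun j _ =>
      ((((h2 q).matrix_mul (h1.pow _)).matrix_mul (h2 q)).matrix_mul (h1.pow _)).matrix_trace
  have h0 : ∑ q, ∫ θ, ((gramSecondDeriv Λ q (phaseWindow θ) *
        gramDefect Λ (phaseWindow θ) ^ (2 * s + 1)).trace +
      ∑ j ∈ Finset.range (2 * s + 1), (gramDeriv Λ q (phaseWindow θ) *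
        gramDefect Λ (phaseWindow θ) ^ j * gramDeriv Λ q (phaseWindow θ) *
          gramDefect Λ (phaseWindow θ) ^ (2 * s - j)).trace) ∂phaseMeasure (ZMod n) = 0 :=
    Finset.sum_eq_zero fun q _ => integral_trace_gramSecondDeriv Λ q (2 * s)
  have hc3 : ∀ q, Continuous fun θ : ZMod n → AddCircle (2 * Real.pi) =>
      (gramSecondDeriv Λ q (phaseWindow θ) *
        gramDefect Λ (phaseWindow θ) ^ (2 * s + 1)).trace +
      ∑ j ∈ Finset.range (2 * s + 1), (gramDeriv Λ q (phaseWindow θ) *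
        gramDefect Λ (phaseWindow θ) ^ j * gramDeriv Λ q (phaseWindow θ) *
          gramDefect Λ (phaseWindow θ) ^ (2 * s - j)).trace :=
    fun q => (hc1 q).add (hc2 q)
  rw [← integral_finsetSum _ fun q _ => integrable_phaseMeasure (hc3 q)] at h0
  have hpt : ∀ θ : ZMod n → AddCircle (2 * Real.pi), ∑ q, ((gramSecondDeriv Λ q (phaseWindow θ) *
        gramDefect Λ (phaseWindow θ) ^ (2 * s + 1)).trace +
      ∑ j ∈ Finset.range (2 * s + 1), (gramDeriv Λ q (phaseWindow θ) *
        gramDefect Λ (phaseWindow θ) ^ j * gramDeriv Λ q (phaseWindow θ) *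
          gramDefect Λ (phaseWindow θ) ^ (2 * s - j)).trace) =
      -2 * (gramDefect Λ (phaseWindow θ) ^ (2 * (s + 1))).trace +
      ∑ q, ∑ j ∈ Finset.range (2 * s + 1), (gramDeriv Λ q (phaseWindow θ) *
        gramDefect Λ (phaseWindow θ) ^ j * gramDeriv Λ q (phaseWindow θ) *
          gramDefect Λ (phaseWindow θ) ^ (2 * s - j)).trace := by
    intro θ
    rw [Finset.sum_add_distrib, ← Matrix.trace_sum, ← Finset.sum_mul, sum_gramSecondDeriv,
      Matrix.smul_mul, Matrix.trace_smul, smul_eq_mul, ← pow_succ']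
    rfl
  simp_rw [hpt] at h0
  have hre := congrArg Complex.re h0
  rw [← Complex.reCLM_apply, ← ContinuousLinearMap.integral_comp_comm] at hre
  · simp only [Complex.reCLM_apply, Complex.add_re, Complex.re_sum, Complex.zero_re] at hre
    have hre2 : ∀ z : ℂ, (-2 * z).re = -2 * z.re := fun z => by simp
    simp only [hre2] at hre
    rw [integral_add, integral_const_mul] at hre
    · simp only [gramTrace]
      linarith
    · exact integrable_phaseMeasure
        ((Complex.continuous_re.comp (h1.pow _).matrix_trace).const_smul (-2 : ℝ))
    · refine integrable_phaseMeasure (continuous_finsetSum _ fun q _ =>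
        continuous_finsetSum _ fun j _ => ?_)
      exact Complex.continuous_re.comp
        ((((h2 q).matrix_mul (h1.pow _)).matrix_mul (h2 q)).matrix_mul (h1.pow _)).matrix_trace
  · exact integrable_phaseMeasure (((h1.pow _).matrix_trace.const_smul (-2 : ℂ)).add
      (continuous_finsetSum _ fun q _ => hc2 q))

end Recursion

/-! ### Tail bound for the Gram matrix -/

section GramTail

variable {n : ℕ} [NeZero n] (Λ : Finset (ZMod n × ZMod n))

lemma sum_gramCoeff_mul_conjTranspose (ε : ZMod n → ℂ) (hε : ∀ q, ‖ε q‖ = 1) :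
    ∑ q, gramCoeff Λ q ε * (gramCoeff Λ q ε)ᴴ = ((Λ.card : ℂ) / n) • (1 + gramDefect Λ ε) := by
  have h : ∀ q, gramCoeff Λ q ε * (gramCoeff Λ q ε)ᴴ =
      (gaborSubmatrix Λ ε)ᴴ * (gaborCoeff Λ q * (gaborCoeff Λ q)ᴴ) * gaborSubmatrix Λ ε := by
    intro q
    rw [gramCoeff, Matrix.conjTranspose_smul, Matrix.smul_mul, Matrix.mul_smul, smul_smul,
      Complex.star_def, Complex.mul_conj', hε, Matrix.conjTranspose_mul,
      Matrix.conjTranspose_conjTranspose]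
    simp only [Complex.ofReal_one, one_pow, one_smul, Matrix.mul_assoc]
  simp_rw [h]
  rw [← Matrix.sum_mul, ← Matrix.mul_sum, sum_gaborCoeff_mul_conjTranspose, one_add_gramDefect,
    Matrix.mul_smul, Matrix.smul_mul, Matrix.mul_one]

lemma sum_conjTranspose_gramCoeff_mul (ε : ZMod n → ℂ) (hε : ∀ q, ‖ε q‖ = 1) :
    ∑ q, (gramCoeff Λ q ε)ᴴ * gramCoeff Λ q ε =
      (1 / n : ℂ) • ∑ mu : Λ, (Matrix.diagonal (reflectionPhase Λ mu.1))ᴴ *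
        (1 + gramDefect Λ fun s => ε (-s))ᵀ * Matrix.diagonal (reflectionPhase Λ mu.1) := by
  rw [← sum_conjTranspose_gaborCoeff_mul_mul]
  refine Finset.sum_congr rfl fun q _ => ?_
  rw [gramCoeff, Matrix.conjTranspose_smul, Matrix.smul_mul, Matrix.mul_smul, smul_smul,
    Complex.star_def, Complex.conj_mul', hε, Matrix.conjTranspose_mul,
    Matrix.conjTranspose_conjTranspose]
  simp only [Complex.ofReal_one, one_pow, one_smul]

/-- The unitary conjugate of the transposed Gram defect of the reflected window. -/
noncomputable def reflectedDefect (ε : ZMod n → ℂ) (mu : Λ) : Matrix Λ Λ ℂ :=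
  (Matrix.diagonal (reflectionPhase Λ mu.1))ᴴ * (gramDefect Λ fun s => ε (-s))ᵀ *
    Matrix.diagonal (reflectionPhase Λ mu.1)

lemma conjTranspose_diagonal_reflectionPhase_mul (mu : Λ) :
    (Matrix.diagonal (reflectionPhase Λ mu.1))ᴴ * Matrix.diagonal (reflectionPhase Λ mu.1) = 1 := by
  rw [Matrix.diagonal_conjTranspose, Matrix.diagonal_mul_diagonal, ← Matrix.diagonal_one]
  congr 1
  ext lam
  rw [Pi.star_apply, Complex.star_def, Complex.conj_mul', reflectionPhase, norm_stdAddChar]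
  simp

lemma diagonal_reflectionPhase_mul_conjTranspose (mu : Λ) :
    Matrix.diagonal (reflectionPhase Λ mu.1) * (Matrix.diagonal (reflectionPhase Λ mu.1))ᴴ = 1 :=
  mul_eq_one_comm.mp (conjTranspose_diagonal_reflectionPhase_mul Λ mu)

lemma isHermitian_reflectedDefect (ε : ZMod n → ℂ) (mu : Λ) :
    (reflectedDefect Λ ε mu).IsHermitian :=
  Matrix.isHermitian_conjTranspose_mul_mul _ (isHermitian_gramDefect Λ _).transpose

lemma reflectedDefect_pow (ε : ZMod n → ℂ) (mu : Λ) (k : ℕ) :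
    reflectedDefect Λ ε mu ^ k = (Matrix.diagonal (reflectionPhase Λ mu.1))ᴴ *
      ((gramDefect Λ fun s => ε (-s)) ^ k)ᵀ * Matrix.diagonal (reflectionPhase Λ mu.1) := by
  induction k with
  | zero =>
    rw [pow_zero, pow_zero, Matrix.transpose_one, mul_one,
      conjTranspose_diagonal_reflectionPhase_mul]
  | succ k ih =>
    rw [pow_succ, ih, reflectedDefect, pow_succ', Matrix.transpose_mul]
    simp only [mul_assoc]
    rw [← mul_assoc (Matrix.diagonal (reflectionPhase Λ mu.1)) (_ᴴ),
      diagonal_reflectionPhase_mul_conjTranspose, one_mul]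

lemma re_trace_reflectedDefect_pow (ε : ZMod n → ℂ) (mu : Λ) (k : ℕ) :
    (reflectedDefect Λ ε mu ^ k).trace.re = gramTrace Λ k fun s => ε (-s) := by
  rw [reflectedDefect_pow, mul_assoc, Matrix.trace_mul_comm, mul_assoc,
    diagonal_reflectionPhase_mul_conjTranspose, mul_one, Matrix.trace_transpose, gramTrace]

/-- The trace inequalities applied to the derivatives of the Gram matrix. With `a ≤ 1/4 + a²` the
contributions `(1 + H) H ^ (2 s)` and `(1 + R) H ^ (2 s)`, where `R` is a reflected defect, cost `5/4`
of `Tr H ^ (2 s)` each and one trace of degree `2 s + 2`. -/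
lemma sum_re_trace_gramDeriv_le (ε : ZMod n → ℂ) (hε : ∀ q, ‖ε q‖ = 1) (s : ℕ) :
    ∑ q, ∑ j ∈ Finset.range (2 * s + 1), (gramDeriv Λ q ε * gramDefect Λ ε ^ j *
        gramDeriv Λ q ε * gramDefect Λ ε ^ (2 * s - j)).trace.re ≤
      (2 * s + 1) * (2 * ((Λ.card : ℝ) / n * (5 / 2 * gramTrace Λ (2 * s) ε +
        gramTrace Λ (2 * (s + 1)) ε + ((gramTrace Λ (2 * (s + 1)) fun r => ε (-r)) +
          s * gramTrace Λ (2 * (s + 1)) ε) / (s + 1)))) := by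
  have hH := isHermitian_gramDefect Λ ε
  set H := gramDefect Λ ε with hHdef
  have hT0 : (H ^ (2 * s)).trace.re = gramTrace Λ (2 * s) ε := rfl
  have hT1 : (H ^ (2 * (s + 1))).trace.re = gramTrace Λ (2 * (s + 1)) ε := rfl
  have h1 : ∀ q, ∑ j ∈ Finset.range (2 * s + 1), (gramDeriv Λ q ε * H ^ j *
      gramDeriv Λ q ε * H ^ (2 * s - j)).trace.re ≤
      (2 * s + 1) * (2 * ((gramCoeff Λ q ε * (gramCoeff Λ q ε)ᴴ * H ^ (2 * s)).trace.re +
        ((gramCoeff Λ q ε)ᴴ * gramCoeff Λ q ε * H ^ (2 * s)).trace.re)) := fun q =>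
    (sum_re_trace_mul_pow_mul_mul_pow_le (isHermitian_gramDeriv Λ q ε) hH s).trans
      (mul_le_mul_of_nonneg_left (re_trace_sq_mul_pow_le hH (gramCoeff Λ q ε) s) (by positivity))
  refine (Finset.sum_le_sum fun q _ => h1 q).trans ?_
  rw [← Finset.mul_sum, ← Finset.mul_sum, Finset.sum_add_distrib]
  refine mul_le_mul_of_nonneg_left (mul_le_mul_of_nonneg_left ?_ (by norm_num)) (by positivity)
  have hA : ∑ q, (gramCoeff Λ q ε * (gramCoeff Λ q ε)ᴴ * H ^ (2 * s)).trace.re ≤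
      (Λ.card : ℝ) / n * (5 / 4 * gramTrace Λ (2 * s) ε + gramTrace Λ (2 * (s + 1)) ε) := by
    rw [← Complex.re_sum, ← Matrix.trace_sum, ← Finset.sum_mul,
      sum_gramCoeff_mul_conjTranspose Λ ε hε, Matrix.smul_mul, Matrix.trace_smul, smul_eq_mul]
    have hc : ((Λ.card : ℂ) / n) = ((Λ.card / n : ℝ) : ℂ) := by push_cast; rfl
    rw [hc, Complex.re_ofReal_mul, add_mul, one_mul, Matrix.trace_add, Complex.add_re]
    refine mul_le_mul_of_nonneg_left ?_ (by positivity)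
    have h2 := re_trace_mul_pow_le hH hH s
    have h3 : H ^ 2 * H ^ (2 * s) = H ^ (2 * (s + 1)) := by rw [← pow_add]; congr 1; ring
    rw [h3] at h2
    rw [← hHdef]
    linarith
  have hB : ∑ q, ((gramCoeff Λ q ε)ᴴ * gramCoeff Λ q ε * H ^ (2 * s)).trace.re ≤
      (Λ.card : ℝ) / n * (5 / 4 * gramTrace Λ (2 * s) ε +
        ((gramTrace Λ (2 * (s + 1)) fun r => ε (-r)) +
          s * gramTrace Λ (2 * (s + 1)) ε) / (s + 1)) := by
    have hR : ∀ mu : Λ, (Matrix.diagonal (reflectionPhase Λ mu.1))ᴴ *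
        (1 + gramDefect Λ fun s => ε (-s))ᵀ * Matrix.diagonal (reflectionPhase Λ mu.1) =
        1 + reflectedDefect Λ ε mu := by
      intro mu
      rw [Matrix.transpose_add, Matrix.transpose_one, mul_add, add_mul, mul_one,
        conjTranspose_diagonal_reflectionPhase_mul, reflectedDefect]
    rw [← Complex.re_sum, ← Matrix.trace_sum, ← Finset.sum_mul,
      sum_conjTranspose_gramCoeff_mul Λ ε hε, Matrix.smul_mul, Matrix.trace_smul, smul_eq_mul]
    have hc : (1 / (n : ℂ)) = ((1 / n : ℝ) : ℂ) := by push_cast; rfl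
    rw [hc, Complex.re_ofReal_mul, Finset.sum_mul, Matrix.trace_sum, Complex.re_sum,
      div_eq_mul_one_div (Λ.card : ℝ), mul_comm (Λ.card : ℝ), mul_assoc]
    refine mul_le_mul_of_nonneg_left ?_ (by positivity)
    have hmu : ∀ mu ∈ (Finset.univ : Finset Λ),
        ((Matrix.diagonal (reflectionPhase Λ mu.1))ᴴ * (1 + gramDefect Λ fun s => ε (-s))ᵀ *
          Matrix.diagonal (reflectionPhase Λ mu.1) * H ^ (2 * s)).trace.re ≤
        5 / 4 * gramTrace Λ (2 * s) ε + ((gramTrace Λ (2 * (s + 1)) fun r => ε (-r)) +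
          s * gramTrace Λ (2 * (s + 1)) ε) / (s + 1) := by
      intro mu _
      have hAh := isHermitian_reflectedDefect Λ ε mu
      rw [hR, add_mul, one_mul, Matrix.trace_add, Complex.add_re]
      have h2 := re_trace_mul_pow_le hAh hH s
      have h3 := re_trace_sq_mul_pow_le_young hAh hH s
      rw [re_trace_reflectedDefect_pow] at h3
      have h4 : (reflectedDefect Λ ε mu ^ 2 * H ^ (2 * s)).trace.re ≤
          ((gramTrace Λ (2 * (s + 1)) fun r => ε (-r)) +
            s * gramTrace Λ (2 * (s + 1)) ε) / (s + 1) := by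
        rw [le_div_iff₀ (by positivity), mul_comm]
        exact h3
      linarith
    have h5 := Finset.sum_le_card_nsmul _ _ _ hmu
    rwa [Finset.card_univ, Fintype.card_coe, nsmul_eq_mul] at h5
  refine (add_le_add hA hB).trans (le_of_eq ?_)
  ring

/-- The reflected window has the same law as the window. -/
lemma integral_gramTrace_neg (k : ℕ) :
    ∫ θ, (gramTrace Λ k fun r => phaseWindow θ (-r)) ∂phaseMeasure (ZMod n) =
      ∫ θ, gramTrace Λ k (phaseWindow θ) ∂phaseMeasure (ZMod n) := by
  have h := measurePreserving_piCongrLeft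
    (fun _ : ZMod n => (haarAddCircle : Measure (AddCircle (2 * Real.pi)))) (Equiv.neg (ZMod n))
  have h2 := h.integral_comp' (fun θ => gramTrace Λ k (phaseWindow θ))
  rw [phaseMeasure, ← h2]
  refine integral_congr_ae (Filter.Eventually.of_forall fun θ => ?_)
  refine congrArg (gramTrace Λ k) (funext fun r => ?_)
  rw [phaseWindow, phaseWindow, MeasurableEquiv.coe_piCongrLeft]
  have h3 := Equiv.piCongrLeft_apply_apply (fun _ : ZMod n => AddCircle (2 * Real.pi))
    (Equiv.neg (ZMod n)) θ (-r)
  rw [Equiv.neg_apply, neg_neg] at h3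
  rw [h3]

/-- The expected trace `E Tr H ^ (2 s)`. -/
noncomputable def gramMoment (s : ℕ) : ℝ :=
  ∫ θ, gramTrace Λ (2 * s) (phaseWindow θ) ∂phaseMeasure (ZMod n)

lemma gramMoment_nonneg (s : ℕ) : 0 ≤ gramMoment Λ s :=
  integral_nonneg fun _ => re_trace_pow_nonneg (isHermitian_gramDefect Λ _) s

lemma gramMoment_zero : gramMoment Λ 0 = Λ.card := by
  simp [gramMoment, gramTrace]

/-- The moment recursion. The unknown moment also occurs on the right, with a coefficient which is
small as long as `s` is small compared with `n / S`. -/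
lemma gramMoment_succ_le (s : ℕ) :
    gramMoment Λ (s + 1) ≤ 2 * (2 * s + 1) * ((Λ.card : ℝ) / n) *
      (5 / 4 * gramMoment Λ s + gramMoment Λ (s + 1)) := by
  have hT : ∀ k, Continuous fun θ : ZMod n → AddCircle (2 * Real.pi) =>
      gramTrace Λ k (phaseWindow θ) := fun k => (continuous_gramTrace Λ k).comp continuous_phaseWindow
  have hTn : ∀ k, Continuous fun θ : ZMod n → AddCircle (2 * Real.pi) =>
      gramTrace Λ k fun r => phaseWindow θ (-r) := fun k =>
    (continuous_gramTrace Λ k).comp (continuous_pi fun r =>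
      (continuous_apply (-r)).comp continuous_phaseWindow)
  have hint : ∫ θ, (2 * s + 1) * (2 * ((Λ.card : ℝ) / n *
      (5 / 2 * gramTrace Λ (2 * s) (phaseWindow θ) +
        gramTrace Λ (2 * (s + 1)) (phaseWindow θ) +
          ((gramTrace Λ (2 * (s + 1)) fun r => phaseWindow θ (-r)) +
          s * gramTrace Λ (2 * (s + 1)) (phaseWindow θ)) / (s + 1)))) ∂phaseMeasure (ZMod n) =
      (2 * s + 1) * (2 * ((Λ.card : ℝ) / n * (5 / 2 * gramMoment Λ s + gramMoment Λ (s + 1) +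
        (gramMoment Λ (s + 1) + s * gramMoment Λ (s + 1)) / (s + 1)))) := by
    have i0 := integrable_phaseMeasure (hT (2 * s))
    have i1 := integrable_phaseMeasure (hT (2 * (s + 1)))
    have i2 := integrable_phaseMeasure (hTn (2 * (s + 1)))
    rw [integral_const_mul, integral_const_mul, integral_const_mul, integral_add, integral_add,
      integral_const_mul, integral_div, integral_add, integral_const_mul, integral_gramTrace_neg]
    · rfl
    · exact i2
    · exact i1.const_mul _
    · exact i0.const_mul _
    · exact i1
    · exact (i0.const_mul _).add i1
    · exact (i2.add (i1.const_mul _)).div_const _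
  have h := two_mul_integral_gramTrace Λ s
  have hc1 : Continuous fun θ : ZMod n → AddCircle (2 * Real.pi) =>
      ∑ q, ∑ j ∈ Finset.range (2 * s + 1), (gramDeriv Λ q (phaseWindow θ) *
        gramDefect Λ (phaseWindow θ) ^ j * gramDeriv Λ q (phaseWindow θ) *
          gramDefect Λ (phaseWindow θ) ^ (2 * s - j)).trace.re := by
    have h1 := (continuous_gramDefect Λ).comp (continuous_phaseWindow (n := n))
    have h2 := fun q => (continuous_gramDeriv Λ q).comp (continuous_phaseWindow (n := n))
    simp only [Function.comp_def] at h1 h2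
    exact continuous_finsetSum _ fun q _ => continuous_finsetSum _ fun j _ =>
      Complex.continuous_re.comp
        ((((h2 q).matrix_mul (h1.pow _)).matrix_mul (h2 q)).matrix_mul (h1.pow _)).matrix_trace
  have h3 : 2 * gramMoment Λ (s + 1) ≤ (2 * s + 1) * (2 * ((Λ.card : ℝ) / n *
      (5 / 2 * gramMoment Λ s + gramMoment Λ (s + 1) +
        (gramMoment Λ (s + 1) + s * gramMoment Λ (s + 1)) / (s + 1)))) := by
    rw [← hint, gramMoment, h]
    refine integral_mono (integrable_phaseMeasure hc1) (integrable_phaseMeasure ?_) fun θ => ?_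
    · exact continuous_const.mul (continuous_const.mul (continuous_const.mul
        (((continuous_const.mul (hT _)).add (hT _)).add
          (((hTn _).add (continuous_const.mul (hT _))).div_const _))))
    · exact sum_re_trace_gramDeriv_le Λ (phaseWindow θ) (fun q => norm_phase _) s
  have h4 : (gramMoment Λ (s + 1) + s * gramMoment Λ (s + 1)) / (s + 1) =
      gramMoment Λ (s + 1) := by
    field_simp
    ring
  rw [h4] at h3
  linarith

/-- `(2 m - 1)!! ≤ m ^ m`: opposite odd factors add up to `2 m`. -/
lemma prod_odd_le (m : ℕ) : ∏ k ∈ Finset.range m, (2 * (k : ℝ) + 1) ≤ (m : ℝ) ^ m := by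
  have h : (∏ k ∈ Finset.range m, (2 * (k : ℝ) + 1)) ^ 2 ≤ ((m : ℝ) ^ m) ^ 2 := by
    calc (∏ k ∈ Finset.range m, (2 * (k : ℝ) + 1)) ^ 2
        = (∏ k ∈ Finset.range m, (2 * (k : ℝ) + 1)) *
            ∏ k ∈ Finset.range m, (2 * ((m - 1 - k : ℕ) : ℝ) + 1) := by
          rw [Finset.prod_range_reflect (fun k : ℕ => 2 * (k : ℝ) + 1), sq]
      _ = ∏ k ∈ Finset.range m, ((2 * (k : ℝ) + 1) * (2 * ((m - 1 - k : ℕ) : ℝ) + 1)) :=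
          Finset.prod_mul_distrib.symm
      _ ≤ ∏ _k ∈ Finset.range m, (m : ℝ) ^ 2 := by
          refine Finset.prod_le_prod (fun k _ => by positivity) fun k hk => ?_
          have hk' := Finset.mem_range.mp hk
          have hcast : ((m - 1 - k : ℕ) : ℝ) = m - 1 - k := by
            rw [Nat.cast_sub (by omega), Nat.cast_sub (by omega), Nat.cast_one]
          rw [hcast]
          nlinarith [sq_nonneg ((m : ℝ) - (2 * k + 1))]
      _ = ((m : ℝ) ^ m) ^ 2 := by
          rw [Finset.prod_const, Finset.card_range, ← pow_mul, ← pow_mul, mul_comm]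
  exact le_of_sq_le_sq h (by positivity)

/-- The solution of the moment recursion while its self-referential part has coefficient at most
`1/10`; then `4 · (5/4) · 2 / (1 - 1/10) = 100/9`. -/
lemma four_pow_mul_gramMoment_le {m : ℕ}
    (hm : 2 * (2 * (m : ℝ) - 1) * ((Λ.card : ℝ) / n) ≤ 1 / 10) :
    4 ^ m * gramMoment Λ m ≤ Λ.card * (100 / 9 * m * ((Λ.card : ℝ) / n)) ^ m := by
  set a : ℝ := (Λ.card : ℝ) / n with ha
  have ha0 : 0 ≤ a := by positivity
  have h : ∀ k ≤ m, 4 ^ k * gramMoment Λ k ≤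
      Λ.card * ((100 / 9 * a) ^ k * ∏ j ∈ Finset.range k, (2 * (j : ℝ) + 1)) := by
    intro k
    induction k with
    | zero => intro _; simp [gramMoment_zero]
    | succ k ih =>
      intro hk
      have ih' := ih (by omega)
      have hr := gramMoment_succ_le Λ k
      rw [← ha] at hr
      have hk' : (k : ℝ) + 1 ≤ m := by exact_mod_cast hk
      have hak : 2 * (2 * (k : ℝ) + 1) * a ≤ 1 / 10 := by
        refine le_trans ?_ hm
        gcongr
        linarith
      have h0 := gramMoment_nonneg Λ k
      have h1 := gramMoment_nonneg Λ (k + 1)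
      have h2 : 4 * gramMoment Λ (k + 1) ≤ 100 / 9 * a * (2 * k + 1) * gramMoment Λ k := by
        nlinarith [mul_le_mul_of_nonneg_right hak h1]
      rw [Finset.prod_range_succ, pow_succ, pow_succ]
      calc 4 ^ k * 4 * gramMoment Λ (k + 1) = 4 ^ k * (4 * gramMoment Λ (k + 1)) := by ring
        _ ≤ 4 ^ k * (100 / 9 * a * (2 * k + 1) * gramMoment Λ k) := by gcongr
        _ = (100 / 9 * a * (2 * k + 1)) * (4 ^ k * gramMoment Λ k) := by ring
        _ ≤ (100 / 9 * a * (2 * k + 1)) *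
            (Λ.card * ((100 / 9 * a) ^ k * ∏ j ∈ Finset.range k, (2 * (j : ℝ) + 1))) := by gcongr
        _ = _ := by ring
  refine (h m le_rfl).trans ?_
  have hp := prod_odd_le m
  calc (Λ.card : ℝ) * ((100 / 9 * a) ^ m * ∏ j ∈ Finset.range m, (2 * (j : ℝ) + 1))
      ≤ Λ.card * ((100 / 9 * a) ^ m * (m : ℝ) ^ m) := by gcongr
    _ = Λ.card * (100 / 9 * m * a) ^ m := by rw [← mul_pow]; ring

/-- Markov's inequality for the trace moments, with a moment of order about `n / (8 e S)`. -/
lemma exists_measureReal_gramTrace_le_of_le (hΛ : 1 ≤ Λ.card)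
    (hN : 1 / 2 ≤ (n : ℝ) / (16 * Real.exp 1 * Λ.card)) :
    ∃ m : ℕ, (phaseMeasure (ZMod n)).real
        {θ | (1 / 4) ^ m ≤ gramTrace Λ (2 * m) (phaseWindow θ)} ≤
      Λ.card * Real.exp (-((n : ℝ) / (16 * Real.exp 1 * Λ.card))) := by
  have hS : (1 : ℝ) ≤ Λ.card := by exact_mod_cast hΛ
  have hS0 : (0 : ℝ) < Λ.card := by linarith
  have hn0 : (0 : ℝ) < n := by exact_mod_cast NeZero.pos n
  have he := Real.exp_pos 1
  set N : ℝ := (n : ℝ) / (16 * Real.exp 1 * Λ.card) with hNdef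
  have hN0 : 0 < N := by linarith
  have ha : (Λ.card : ℝ) / n = 1 / (16 * Real.exp 1 * N) := by
    rw [hNdef]; field_simp
  set m := ⌊N + 1 / 2⌋₊ with hm
  have hm1 : (m : ℝ) ≤ N + 1 / 2 := Nat.floor_le (by linarith)
  have hm2 : N + 1 / 2 < m + 1 := Nat.lt_floor_add_one _
  have hm3 : (1 : ℝ) ≤ m := by
    have : 1 ≤ m := Nat.le_floor (by norm_num; linarith)
    exact_mod_cast this
  refine ⟨m, ?_⟩
  have hbound := four_pow_mul_gramMoment_le Λ (m := m) (by
    rw [ha, mul_one_div, div_le_div_iff₀ (by positivity) (by norm_num)]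
    have h25 : (2.5 : ℝ) ≤ Real.exp 1 := by linarith [Real.exp_one_gt_d9]
    nlinarith)
  have hmarkov := mul_meas_ge_le_integral_of_nonneg (μ := phaseMeasure (ZMod n))
    (f := fun θ => gramTrace Λ (2 * m) (phaseWindow θ))
    (Filter.Eventually.of_forall fun θ => re_trace_pow_nonneg (isHermitian_gramDefect Λ _) m)
    (integrable_phaseMeasure ((continuous_gramTrace Λ (2 * m)).comp continuous_phaseWindow))
    ((1 / 4) ^ m)
  have h1 : (phaseMeasure (ZMod n)).real
      {θ | (1 / 4) ^ m ≤ gramTrace Λ (2 * m) (phaseWindow θ)} ≤ 4 ^ m * gramMoment Λ m := by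
    have h4 : (4 : ℝ) ^ m * (1 / 4) ^ m = 1 := by rw [← mul_pow]; norm_num
    have h5 := mul_le_mul_of_nonneg_left hmarkov (by positivity : (0 : ℝ) ≤ 4 ^ m)
    rw [← mul_assoc, h4, one_mul] at h5
    exact h5
  refine h1.trans (hbound.trans (mul_le_mul_of_nonneg_left ?_ hS0.le))
  have hexp : Real.exp (-N) = Real.exp (-(N / m)) ^ m := by
    rw [← Real.exp_nat_mul]
    congr 1
    field_simp
  rw [hexp]
  refine pow_le_pow_left₀ (by positivity) ?_ m
  -- With `u = N / m ∈ [1/2, 3/2]` the claim is `25/36 ≤ u e^(1-u)`, and `u (2 - u) ≥ 3/4`.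
  have h6 : 2 - N / m ≤ Real.exp (1 - N / m) := by
    have := Real.add_one_le_exp (1 - N / m)
    linarith
  have h7 : Real.exp (-(N / m)) = Real.exp (1 - N / m) / Real.exp 1 := by
    rw [← Real.exp_sub]; congr 1; ring
  rw [h7, ha, mul_one_div, div_le_div_iff₀ (by positivity) he]
  have h8 : 3 / 4 * m ≤ (2 - N / m) * N := by
    have h9 : (2 - N / m) * N = (2 * m * N - N ^ 2) / m := by field_simp
    rw [h9, le_div_iff₀ (by linarith)]
    nlinarith
  have h10 : (2 - N / m) * N ≤ Real.exp (1 - N / m) * N := by gcongr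
  nlinarith

end GramTail

lemma one_le_exp_sq_div : 1 ≤ Real.exp 1 ^ 2 / (4 * (Real.exp 1 - 1)) := by
  have h : 1 < Real.exp 1 := by simp
  rw [le_div_iff₀ (by linarith)]
  nlinarith [sq_nonneg (Real.exp 1 - 2)]

lemma gramDefect_eq_zero_of_card_eq_one {n : ℕ} [NeZero n] {Λ : Finset (ZMod n × ZMod n)}
    (hΛ : Λ.card = 1) {ε : ZMod n → ℂ} (hε : ∀ q, ‖ε q‖ = 1) : gramDefect Λ ε = 0 := by
  have hsub : Subsingleton Λ := by
    rw [← Fintype.card_le_one_iff_subsingleton, Fintype.card_coe, hΛ]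
  have hn : (n : ℂ) ≠ 0 := Nat.cast_ne_zero.mpr (NeZero.ne n)
  ext lam lam'
  rw [Subsingleton.elim lam' lam, gramDefect, Matrix.sub_apply, Matrix.one_apply_eq,
    Matrix.mul_apply]
  have h : ∀ p : ZMod n, (gaborSubmatrix Λ ε)ᴴ lam p * gaborSubmatrix Λ ε p lam = 1 / n := by
    intro p
    rw [Matrix.conjTranspose_apply, Complex.star_def, Complex.conj_mul', gaborSubmatrix,
      Matrix.of_apply, norm_mul, norm_mul, hε, norm_stdAddChar, mul_one, mul_one,
      ← windowScale_mul_self, ← Complex.conj_mul', conj_windowScale]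
  simp_rw [h]
  simp [hn]

/-- For `n / (16 e S) < 1/2` the bound is trivial when `S ≥ 2`, while for `S = 1` the Gram matrix
is the identity. -/
lemma exists_measureReal_gramTrace_le {n : ℕ} [NeZero n] (Λ : Finset (ZMod n × ZMod n))
    (hΛ : 1 ≤ Λ.card) :
    ∃ m : ℕ, (phaseMeasure (ZMod n)).real
        {θ | (1 / 4) ^ m ≤ gramTrace Λ (2 * m) (phaseWindow θ)} ≤
      Real.exp 1 ^ 2 / (4 * (Real.exp 1 - 1)) * Λ.card *
        Real.exp (-((n : ℝ) / (16 * Real.exp 1 * Λ.card))) := by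
  have hC := one_le_exp_sq_div
  have hC0 : 0 ≤ Real.exp 1 ^ 2 / (4 * (Real.exp 1 - 1)) := zero_le_one.trans hC
  rcases le_or_gt (1 / 2) ((n : ℝ) / (16 * Real.exp 1 * Λ.card)) with hN | hN
  · obtain ⟨m, hm⟩ := exists_measureReal_gramTrace_le_of_le Λ hΛ hN
    refine ⟨m, hm.trans ?_⟩
    rw [mul_assoc (_ / _)]
    exact le_mul_of_one_le_left (by positivity) hC
  · rcases hΛ.eq_or_lt with h1 | h2
    · refine ⟨1, ?_⟩
      have hempty : {θ : ZMod n → AddCircle (2 * Real.pi) |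
          (1 / 4 : ℝ) ^ 1 ≤ gramTrace Λ (2 * 1) (phaseWindow θ)} = ∅ := by
        refine Set.eq_empty_of_forall_notMem fun θ hθ => ?_
        have hθ' : (1 / 4 : ℝ) ^ 1 ≤ gramTrace Λ (2 * 1) (phaseWindow θ) := hθ
        rw [gramTrace, gramDefect_eq_zero_of_card_eq_one h1.symm (ε := phaseWindow θ)
          fun q => norm_phase _] at hθ'
        norm_num at hθ'
      rw [hempty, measureReal_empty]
      positivity
    · refine ⟨0, measureReal_le_one.trans ?_⟩
      have hS : (2 : ℝ) ≤ Λ.card := by exact_mod_cast h2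
      have he : 1 / 2 ≤ Real.exp (-((n : ℝ) / (16 * Real.exp 1 * Λ.card))) := by
        have := Real.add_one_le_exp (-((n : ℝ) / (16 * Real.exp 1 * Λ.card)))
        linarith
      calc (1 : ℝ) = 1 * 2 * (1 / 2) := by norm_num
        _ ≤ _ := by gcongr

/-! ### Mutual coherence -/

section Coherence

variable {n : ℕ} [NeZero n]

/-- The autocorrelation `∑ e^{2πi l r / n} ε_{r+k} conj ε_r` with index `(k, l)`. -/
noncomputable def autocorrelation (mu : ZMod n × ZMod n) (ε : ZMod n → ℂ) : ℂ :=
  ∑ r, ZMod.stdAddChar (mu.2 * r) * ε (r + mu.1) * conj (ε r)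

lemma continuous_autocorrelation (mu : ZMod n × ZMod n) : Continuous (autocorrelation mu) := by
  have := Complex.continuous_conj
  unfold autocorrelation
  fun_prop

/-- Pure modulations of a window of constant modulus are orthogonal. -/
lemma autocorrelation_eq_zero {mu : ZMod n × ZMod n} (h1 : mu.1 = 0) (h2 : mu ≠ 0)
    {ε : ZMod n → ℂ} (hε : ∀ q, ‖ε q‖ = 1) : autocorrelation mu ε = 0 := by
  have h3 : mu.2 ≠ 0 := fun h => h2 (Prod.ext h1 h)
  have h : ∀ r, ZMod.stdAddChar (mu.2 * r) * ε (r + mu.1) * conj (ε r) =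
      ZMod.stdAddChar (mu.2 * r) := by
    intro r
    rw [h1, add_zero, mul_assoc, Complex.mul_conj', hε]
    simp
  rw [autocorrelation]
  simp_rw [h]
  rw [sum_stdAddChar_mul, if_neg h3]

lemma norm_conjTranspose_gaborMatrix_mul_self_apply (ε : ZMod n → ℂ)
    (lam lam' : ZMod n × ZMod n) :
    ‖((gaborMatrix (normalizedWindow ε))ᴴ * gaborMatrix (normalizedWindow ε)) lam lam'‖ =
      1 / n * ‖autocorrelation (lam' - lam) ε‖ := by
  have h : ((gaborMatrix (normalizedWindow ε))ᴴ * gaborMatrix (normalizedWindow ε)) lam lam' =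
      1 / n * ZMod.stdAddChar (-((lam' - lam).2 * lam.1)) * autocorrelation (lam' - lam) ε := by
    rw [Matrix.mul_apply, autocorrelation, Finset.mul_sum]
    refine Fintype.sum_equiv (Equiv.addLeft lam.1) _ _ fun p => ?_
    rw [Matrix.conjTranspose_apply, gaborMatrix_normalizedWindow_apply,
      gaborMatrix_normalizedWindow_apply, Complex.star_def, map_mul, map_mul, conj_windowScale,
      conj_stdAddChar, Equiv.coe_addLeft]
    have e1 : lam.1 + p + (lam' - lam).1 = lam'.1 + p := by rw [Prod.fst_sub]; ring
    have hchar : ZMod.stdAddChar (-(lam.2 * p)) * ZMod.stdAddChar (lam'.2 * p) =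
        ZMod.stdAddChar (-((lam' - lam).2 * lam.1)) *
          (ZMod.stdAddChar ((lam' - lam).2 * (lam.1 + p)) : ℂ) := by
      rw [← AddChar.map_add_eq_mul, ← AddChar.map_add_eq_mul, Prod.snd_sub]
      congr 1
      ring
    rw [e1]
    have hw := windowScale_mul_self (n := n)
    linear_combination (windowScale n * windowScale n * ε (lam'.1 + p) *
      conj (ε (lam.1 + p))) * hchar + (ε (lam'.1 + p) * conj (ε (lam.1 + p)) *
      ZMod.stdAddChar (-((lam' - lam).2 * lam.1)) *
          ZMod.stdAddChar ((lam' - lam).2 * (lam.1 + p))) * hw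
  rw [h, norm_mul, norm_mul, norm_stdAddChar, mul_one, norm_div, norm_one, Complex.norm_natCast]

/-- With large probability all inner products of distinct columns are at most
`√(σ log n / n)`. -/
lemma measureReal_autocorrelation_le (hn : 2 ≤ n) {σ : ℝ} (hσ : 0 < σ) :
    (phaseMeasure (ZMod n)).real {θ | ∃ mu : ZMod n × ZMod n, mu ≠ 0 ∧
        Real.sqrt (n * σ * Real.log n) ≤ ‖autocorrelation mu (phaseWindow θ)‖} ≤
      4 * (n : ℝ) ^ (-(σ / 4 - 2)) := by
  have hn0 : (0 : ℝ) < n := by exact_mod_cast NeZero.pos n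
  have hlog : 0 < Real.log n := Real.log_pos (by exact_mod_cast hn)
  have hu : 0 < Real.sqrt (n * σ * Real.log n) := Real.sqrt_pos.mpr (by positivity)
  have hmu : ∀ mu : ZMod n × ZMod n, (phaseMeasure (ZMod n)).real {θ | mu ≠ 0 ∧
      Real.sqrt (n * σ * Real.log n) ≤ ‖autocorrelation mu (phaseWindow θ)‖} ≤
      4 * (n : ℝ) ^ (-(σ / 4)) := by
    intro mu
    by_cases hk : mu.1 = 0
    · have hempty : {θ : ZMod n → AddCircle (2 * Real.pi) | mu ≠ 0 ∧
          Real.sqrt (n * σ * Real.log n) ≤ ‖autocorrelation mu (phaseWindow θ)‖} = ∅ := by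
        refine Set.eq_empty_of_forall_notMem fun θ hθ => ?_
        have h1 := hθ.2
        rw [autocorrelation_eq_zero hk hθ.1 (ε := phaseWindow θ) fun q => norm_phase _,
          norm_zero] at h1
        linarith
      rw [hempty, measureReal_empty]
      positivity
    · have h := measureReal_le_norm_autocorrelation hk
        (fun r => ZMod.stdAddChar (mu.2 * r)) (fun r => (norm_stdAddChar _).le) hu.le
      rw [Real.sq_sqrt (by positivity)] at h
      refine (measureReal_mono fun θ hθ => hθ.2).trans (h.trans (le_of_eq ?_))
      rw [Real.rpow_def_of_pos hn0]
      congr 2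
      field_simp
  calc _ ≤ (phaseMeasure (ZMod n)).real (⋃ mu : ZMod n × ZMod n, {θ | mu ≠ 0 ∧
        Real.sqrt (n * σ * Real.log n) ≤ ‖autocorrelation mu (phaseWindow θ)‖}) :=
        measureReal_mono fun θ hθ => Set.mem_iUnion.mpr hθ
    _ ≤ ∑ mu : ZMod n × ZMod n, (phaseMeasure (ZMod n)).real {θ | mu ≠ 0 ∧
        Real.sqrt (n * σ * Real.log n) ≤ ‖autocorrelation mu (phaseWindow θ)‖} :=
        measureReal_iUnion_fintype_le _
    _ ≤ ∑ _mu : ZMod n × ZMod n, 4 * (n : ℝ) ^ (-(σ / 4)) := Finset.sum_le_sum fun mu _ => hmu mu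
    _ = 4 * (n : ℝ) ^ (-(σ / 4 - 2)) := by
        rw [Finset.sum_const, Finset.card_univ, Fintype.card_prod, ZMod.card, nsmul_eq_mul,
          show -(σ / 4 - 2) = -(σ / 4) + 2 by ring, Real.rpow_add hn0, Real.rpow_two]
        push_cast
        ring

end Coherence

/-! ### Dual certificates for Basis Pursuit -/

lemma conj_complexSgn_mul_self (z : ℂ) : conj (complexSgn z) * z = ‖z‖ := by
  by_cases hz : z = 0
  · simp [hz]
  · have h : (‖z‖ : ℂ) ≠ 0 := by exact_mod_cast norm_ne_zero_iff.mpr hz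
    rw [complexSgn, map_div₀, Complex.conj_ofReal, div_mul_eq_mul_div, Complex.conj_mul']
    field_simp

/-- A vector `w` such that `A* w` agrees with the signs of `x` on the support of `x` and is smaller
than `1` in modulus elsewhere certifies that `x` is the only solution of Basis Pursuit, provided
that `A` is injective on vectors supported where `x` is. -/
lemma basisPursuitRecovers_of_certificate {κ ι : Type*} [Fintype κ] [Fintype ι]
    (A : Matrix κ ι ℂ) (x : ι → ℂ) (w : κ → ℂ)
    (hsupp : ∀ i, x i ≠ 0 → (Aᴴ *ᵥ w) i = complexSgn (x i))
    (hoff : ∀ i, x i = 0 → ‖(Aᴴ *ᵥ w) i‖ < 1)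
    (hinj : ∀ v : ι → ℂ, A *ᵥ v = 0 → (∀ i, x i = 0 → v i = 0) → v = 0) :
    BasisPursuitRecovers A x := by
  set c := Aᴴ *ᵥ w with hc
  have hpair : ∀ z : ι → ℂ, ∑ i, conj (c i) * z i = star w ⬝ᵥ (A *ᵥ z) := by
    intro z
    have h := Matrix.star_mulVec Aᴴ w
    rw [Matrix.conjTranspose_conjTranspose] at h
    rw [Matrix.dotProduct_mulVec, ← h]
    rfl
  have hx : l1Norm x = (∑ i, conj (c i) * x i).re := by
    rw [l1Norm, Complex.re_sum]
    refine Finset.sum_congr rfl fun i _ => ?_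
    by_cases hi : x i = 0
    · simp [hi]
    · rw [hsupp i hi, conj_complexSgn_mul_self, Complex.ofReal_re]
  have hcle : ∀ i, ‖c i‖ ≤ 1 := by
    intro i
    by_cases hi : x i = 0
    · exact (hoff i hi).le
    · rw [hsupp i hi, complexSgn, norm_div, Complex.norm_real, norm_norm]
      exact div_self_le_one _
  have hterm : ∀ (z : ι → ℂ) (i : ι), (conj (c i) * z i).re ≤ ‖c i‖ * ‖z i‖ := by
    intro z i
    refine (Complex.re_le_norm _).trans (le_of_eq ?_)
    rw [norm_mul, RCLike.norm_conj]
  have hlt : ∀ z : ι → ℂ, A *ᵥ z = A *ᵥ x → z ≠ x → l1Norm x < l1Norm z := by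
    intro z hz hne
    have hex : ∃ i, x i = 0 ∧ z i ≠ 0 := by
      by_contra hcon
      push Not at hcon
      refine hne (sub_eq_zero.mp (hinj (z - x) ?_ fun i hi => ?_))
      · rw [Matrix.mulVec_sub, hz, sub_self]
      · rw [Pi.sub_apply, hcon i hi, hi, sub_zero]
    obtain ⟨j, hj, hzj⟩ := hex
    rw [hx, hpair, ← hz, ← hpair, Complex.re_sum, l1Norm]
    refine Finset.sum_lt_sum (fun i _ => (hterm z i).trans
      (mul_le_of_le_one_left (norm_nonneg _) (hcle i))) ⟨j, Finset.mem_univ j, ?_⟩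
    exact (hterm z j).trans_lt
      (mul_lt_of_lt_one_left (norm_pos_iff.mpr hzj) (hoff j hj))
  intro z
  constructor
  · intro hz
    by_contra hne
    exact absurd (hlt z hz.1 hne) (not_lt.mpr (hz.2 x rfl))
  · rintro rfl
    refine ⟨rfl, fun v hv => ?_⟩
    by_cases hvz : v = z
    · rw [hvz]
    · exact (hlt v hv hvz).le

section Certificate

variable {n : ℕ} [NeZero n] (Λ : Finset (ZMod n × ZMod n))

/-- The matrix `Ψ* Ψ_Λ (Ψ_Λ* Ψ_Λ)⁻¹`, which maps the signs of `x` to `Ψ* w` for the least squares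
certificate `w = Ψ_Λ (Ψ_Λ* Ψ_Λ)⁻¹ sgn x`. -/
noncomputable def certificateMatrix (ε : ZMod n → ℂ) : Matrix (ZMod n × ZMod n) Λ ℂ :=
  (gaborMatrix (normalizedWindow ε))ᴴ * gaborSubmatrix Λ ε * (1 + gramDefect Λ ε)⁻¹

lemma gaborSubmatrix_apply (ε : ZMod n → ℂ) (p : ZMod n) (lam : Λ) :
    gaborSubmatrix Λ ε p lam = gaborMatrix (normalizedWindow ε) p lam.1 :=
  (gaborMatrix_normalizedWindow_apply ε p lam.1).symm

lemma isUnit_one_add_gramDefect {ε : ZMod n → ℂ} {m : ℕ}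
    (h : gramTrace Λ (2 * m) ε < (1 / 4) ^ m) : IsUnit (1 + gramDefect Λ ε) := by
  rw [← Matrix.mulVec_injective_iff_isUnit]
  refine (injective_iff_map_eq_zero (Matrix.mulVecLin (1 + gramDefect Λ ε))).mpr fun v hv => ?_
  have hv' : (1 + gramDefect Λ ε) *ᵥ v = 0 := hv
  have h1 := sum_norm_sq_le_of_trace_pow_lt (isHermitian_gramDefect Λ ε) h v
  rw [hv'] at h1
  simp only [Pi.zero_apply, norm_zero, ne_eq, OfNat.ofNat_ne_zero, not_false_eq_true, zero_pow,
    Finset.sum_const_zero, mul_zero] at h1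
  ext i
  have h2 := (Finset.single_le_sum (f := fun i => ‖v i‖ ^ 2) (fun i _ => sq_nonneg _)
    (Finset.mem_univ i)).trans h1
  have h3 : ‖v i‖ = 0 := by nlinarith [norm_nonneg (v i)]
  simpa using h3

/-- On `Λ` the least squares certificate reproduces the signs of `x`, so only its values outside `Λ`
have to be controlled. -/
lemma basisPursuitRecovers_of_certificateMatrix {ε : ZMod n → ℂ} {m : ℕ}
    (h : gramTrace Λ (2 * m) ε < (1 / 4) ^ m) {x : ZMod n × ZMod n → ℂ}
    (hx : Function.support x = (Λ : Set (ZMod n × ZMod n)))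
    (hoff : ∀ rho ∉ Λ, ‖(certificateMatrix Λ ε *ᵥ fun lam : Λ => complexSgn (x lam.1)) rho‖ < 1) :
    BasisPursuitRecovers (gaborMatrix (normalizedWindow ε)) x := by
  have hunit := isUnit_one_add_gramDefect Λ h
  have hdet : IsUnit (1 + gramDefect Λ ε).det := (Matrix.isUnit_iff_isUnit_det _).mp hunit
  have hmem : ∀ i, x i ≠ 0 ↔ i ∈ Λ := by
    intro i
    rw [← Function.mem_support, hx, Finset.mem_coe]
  set s : Λ → ℂ := fun lam => complexSgn (x lam.1) with hs
  have hcert : (gaborMatrix (normalizedWindow ε))ᴴ *ᵥ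
      (gaborSubmatrix Λ ε *ᵥ ((1 + gramDefect Λ ε)⁻¹ *ᵥ s)) = certificateMatrix Λ ε *ᵥ s := by
    rw [Matrix.mulVec_mulVec, Matrix.mulVec_mulVec, certificateMatrix, Matrix.mul_assoc]
  refine basisPursuitRecovers_of_certificate _ x
    (gaborSubmatrix Λ ε *ᵥ ((1 + gramDefect Λ ε)⁻¹ *ᵥ s)) ?_ ?_ ?_
  · intro i hi
    have hi' : i ∈ Λ := (hmem i).mp hi
    have h1 : ((gaborMatrix (normalizedWindow ε))ᴴ *ᵥ
        (gaborSubmatrix Λ ε *ᵥ ((1 + gramDefect Λ ε)⁻¹ *ᵥ s))) i =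
        ((gaborSubmatrix Λ ε)ᴴ *ᵥ
          (gaborSubmatrix Λ ε *ᵥ ((1 + gramDefect Λ ε)⁻¹ *ᵥ s))) ⟨i, hi'⟩ := by
      simp only [Matrix.mulVec, dotProduct, Matrix.conjTranspose_apply, gaborSubmatrix_apply]
    rw [h1, Matrix.mulVec_mulVec, ← one_add_gramDefect, Matrix.mulVec_mulVec,
      Matrix.mul_nonsing_inv _ hdet, Matrix.one_mulVec]
  · intro i hi
    rw [hcert]
    exact hoff i fun hi' => (hmem i).mpr hi' hi
  · intro v hv hvx
    have hv0 : ∀ i ∉ Λ, v i = 0 := fun i hi => hvx i (by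
      by_contra hne
      exact hi ((hmem i).mp hne))
    have h1 : gaborSubmatrix Λ ε *ᵥ (fun lam : Λ => v lam.1) = 0 := by
      rw [← hv]
      ext p
      simp only [Matrix.mulVec, dotProduct, gaborSubmatrix_apply]
      rw [Finset.sum_coe_sort Λ (fun i => gaborMatrix (normalizedWindow ε) p i * v i)]
      exact Finset.sum_subset (Finset.subset_univ _) fun i _ hi => by rw [hv0 i hi, mul_zero]
    have h2 : (1 + gramDefect Λ ε) *ᵥ (fun lam : Λ => v lam.1) = 0 := by
      rw [one_add_gramDefect, ← Matrix.mulVec_mulVec, h1, Matrix.mulVec_zero]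
    have h3 : (fun lam : Λ => v lam.1) = 0 :=
      Matrix.mulVec_injective_of_isUnit hunit (by rw [h2, Matrix.mulVec_zero])
    ext i
    by_cases hi : i ∈ Λ
    · exact congrFun h3 ⟨i, hi⟩
    · exact hv0 i hi

/-- A row of the certificate matrix outside `Λ` is the image under `(1 + H)⁻¹`, of norm at most `2`,
of the `S` inner products of one column with the columns in `Λ`. -/
lemma sum_norm_sq_certificateMatrix_le {ε : ZMod n → ℂ} {m : ℕ}
    (h : gramTrace Λ (2 * m) ε < (1 / 4) ^ m) {u : ℝ}
    (hcoh : ∀ mu : ZMod n × ZMod n, mu ≠ 0 → ‖autocorrelation mu ε‖ ≤ u)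
    {rho : ZMod n × ZMod n} (hrho : rho ∉ Λ) :
    ∑ lam, ‖certificateMatrix Λ ε rho lam‖ ^ 2 ≤ 4 * Λ.card * (u / n) ^ 2 := by
  have hunit := isUnit_one_add_gramDefect Λ h
  have hdet : IsUnit (1 + gramDefect Λ ε).det := (Matrix.isUnit_iff_isUnit_det _).mp hunit
  have hherm : (1 + gramDefect Λ ε)ᴴ = 1 + gramDefect Λ ε :=
    (Matrix.isHermitian_one.add (isHermitian_gramDefect Λ ε)).eq
  set v : Λ → ℂ := fun lam => conj (certificateMatrix Λ ε rho lam) with hv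
  have h1 := sum_norm_sq_le_of_trace_pow_lt (isHermitian_gramDefect Λ ε) h v
  have h2 : (1 + gramDefect Λ ε) * (certificateMatrix Λ ε)ᴴ =
      (gaborSubmatrix Λ ε)ᴴ * gaborMatrix (normalizedWindow ε) := by
    rw [certificateMatrix, Matrix.conjTranspose_mul, Matrix.conjTranspose_nonsing_inv, hherm,
      ← Matrix.mul_assoc, Matrix.mul_nonsing_inv _ hdet, Matrix.one_mul, Matrix.conjTranspose_mul,
      Matrix.conjTranspose_conjTranspose]
  have h3 : ∀ lam : Λ, ((1 + gramDefect Λ ε) *ᵥ v) lam =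
      ((gaborMatrix (normalizedWindow ε))ᴴ * gaborMatrix (normalizedWindow ε)) lam.1 rho := by
    intro lam
    have h4 := congrFun (congrFun h2 lam) rho
    rw [Matrix.mul_apply] at h4
    change ∑ j, (1 + gramDefect Λ ε) lam j * v j = _
    refine h4.trans ?_
    rw [Matrix.mul_apply, Matrix.mul_apply]
    simp only [Matrix.conjTranspose_apply, gaborSubmatrix_apply]
  have hnv : ∑ lam, ‖certificateMatrix Λ ε rho lam‖ ^ 2 = ∑ lam, ‖v lam‖ ^ 2 := by
    simp only [hv, RCLike.norm_conj]
  have hn0 : (0 : ℝ) < n := by exact_mod_cast NeZero.pos n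
  rw [hnv, mul_assoc]
  refine h1.trans (mul_le_mul_of_nonneg_left ?_ (by norm_num))
  have h5 : ∀ lam ∈ (Finset.univ : Finset Λ),
      ‖((1 + gramDefect Λ ε) *ᵥ v) lam‖ ^ 2 ≤ (u / n) ^ 2 := by
    intro lam _
    rw [h3, norm_conjTranspose_gaborMatrix_mul_self_apply, one_div_mul_eq_div]
    have hne : rho - lam.1 ≠ 0 := fun h0 => hrho (by rw [sub_eq_zero.mp h0]; exact lam.2)
    have := hcoh _ hne
    gcongr
  have h6 := Finset.sum_le_card_nsmul _ _ _ h5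
  rwa [Finset.card_univ, Fintype.card_coe, nsmul_eq_mul] at h6

lemma measurable_certificateMatrix (rho : ZMod n × ZMod n) (lam : Λ) :
    Measurable fun ε : ZMod n → ℂ => certificateMatrix Λ ε rho lam := by
  have h1 : Continuous fun ε : ZMod n → ℂ => gaborMatrix (normalizedWindow ε) := by
    refine continuous_matrix fun p mu => ?_
    simp only [gaborMatrix_normalizedWindow_apply]
    fun_prop
  have h2 : Continuous fun ε : ZMod n → ℂ => 1 + gramDefect Λ ε :=
    continuous_const.add (continuous_gramDefect Λ)
  have h3 : ∀ i j, Measurable fun ε : ZMod n → ℂ => (1 + gramDefect Λ ε)⁻¹ i j := by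
    intro i j
    simp only [Matrix.inv_def, Ring.inverse_eq_inv', Matrix.smul_apply, smul_eq_mul]
    exact h2.matrix_det.measurable.inv.mul (h2.matrix_adjugate.matrix_elem i j).measurable
  simp only [certificateMatrix, Matrix.mul_apply (N := (1 + gramDefect Λ _)⁻¹)]
  refine Finset.measurable_sum _ fun j _ => Measurable.mul ?_ (h3 j lam)
  exact ((h1.matrix_conjTranspose.matrix_mul (continuous_gaborSubmatrix Λ)).matrix_elem
    rho j).measurable

end Certificate

/-! ### Random signs and the failure probability -/

lemma torusUniform_eq_map_phase :
    torusUniform = (haarAddCircle : Measure (AddCircle (2 * Real.pi))).map phase := by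
  have hpi : (0 : ℝ) < 2 * Real.pi := Real.two_pi_pos
  have hofReal0 : ENNReal.ofReal (2 * Real.pi) ≠ 0 := by
    rw [Ne, ENNReal.ofReal_eq_zero, not_le]; exact hpi
  have h1 : ProbabilityTheory.cond volume (Set.Ico (0 : ℝ) (2 * Real.pi)) =
      (ENNReal.ofReal (2 * Real.pi))⁻¹ • volume.restrict (Set.Ioc (0 : ℝ) (0 + 2 * Real.pi)) := by
    rw [ProbabilityTheory.cond, Real.volume_Ico, sub_zero, zero_add,
      Measure.restrict_congr_set Ico_ae_eq_Ioc]
  have h2 : (haarAddCircle : Measure (AddCircle (2 * Real.pi))) =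
      (ENNReal.ofReal (2 * Real.pi))⁻¹ • volume := by
    rw [volume_eq_smul_haarAddCircle, smul_smul, ENNReal.inv_mul_cancel hofReal0
      ENNReal.ofReal_ne_top, one_smul]
  have h3 := (AddCircle.measurePreserving_mk (2 * Real.pi) 0).map_eq
  have h4 : (fun θ : ℝ => Complex.exp (θ * Complex.I)) =
      phase ∘ ((↑) : ℝ → AddCircle (2 * Real.pi)) := by
    ext t
    rw [Function.comp_apply, phase, toCircle_apply_mk, div_self hpi.ne', one_mul, Circle.coe_exp]
  rw [torusUniform, h1, h2, h4, ← Measure.map_map continuous_phase.measurable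
    AddCircle.measurable_mk', Measure.map_smul, h3]

lemma pi_torusUniform (I : Type*) [Fintype I] :
    Measure.pi (fun _ : I => torusUniform) =
      (phaseMeasure I).map fun θ i => phase (θ i) := by
  have h : MeasurePreserving phase (haarAddCircle : Measure (AddCircle (2 * Real.pi)))
      torusUniform := ⟨continuous_phase.measurable, torusUniform_eq_map_phase.symm⟩
  have hprob : IsProbabilityMeasure torusUniform := by
    rw [torusUniform_eq_map_phase]
    exact Measure.isProbabilityMeasure_map continuous_phase.measurable.aemeasurable
  exact (measurePreserving_pi (fun _ : I => haarAddCircle) (fun _ : I => torusUniform)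
    fun _ => h).map_eq.symm

/-- Hoeffding's inequality for sums of independent phases. -/
lemma measureReal_le_norm_sum_mul_phase {I : Type*} [Fintype I] (c : I → ℂ) {v : ℝ} (hv : 0 < v)
    (hc : ∑ i, ‖c i‖ ^ 2 ≤ v) {u : ℝ} (hu : 0 ≤ u) :
    (phaseMeasure I).real {θ | u ≤ ‖∑ i, c i * phase (θ i)‖} ≤
      2 * Real.exp (-(u ^ 2 / (2 * v))) := by
  classical
  let _ : LinearOrder I := LinearOrder.lift' (Fintype.equivFin I) (Fintype.equivFin I).injective
  refine measureReal_le_norm_of_moments (by fun_prop) hv (fun m => ?_) hu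
  have h := integral_norm_sum_mul_phase_pow_le (I := I) (fun i : I => i) (fun i _ => c i)
    (fun i => ‖c i‖ ^ 2) (fun i => continuous_const) (fun i θ => le_rfl) Finset.univ
    (fun _ _ _ _ _ _ _ => rfl) (fun j _ i _ hij => hij.ne) m
  have h0 : 0 ≤ ∑ i, ‖c i‖ ^ 2 := Finset.sum_nonneg fun i _ => sq_nonneg _
  exact h.trans (by gcongr)

lemma measureReal_prod_le_of_slice {X Y : Type*} [MeasurableSpace X] [MeasurableSpace Y]
    {μ : Measure X} {ν : Measure Y} [IsProbabilityMeasure μ] [IsProbabilityMeasure ν]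
    {T : Set (X × Y)} (hT : MeasurableSet T) {c : ℝ} (hc : 0 ≤ c)
    (h : ∀ x, ν.real (Prod.mk x ⁻¹' T) ≤ c) : (μ.prod ν).real T ≤ c := by
  refine ENNReal.toReal_le_of_le_ofReal hc ?_
  rw [Measure.prod_apply hT]
  calc ∫⁻ x, ν (Prod.mk x ⁻¹' T) ∂μ ≤ ∫⁻ _, ENNReal.ofReal c ∂μ := by
        refine lintegral_mono fun x => ?_
        rw [← ofReal_measureReal]
        exact ENNReal.ofReal_le_ofReal (h x)
    _ = ENNReal.ofReal c := by simp

section Failure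

variable {n : ℕ} [NeZero n] (Λ : Finset (ZMod n × ZMod n))

/-- The windows for which the Gram matrix is far from the identity. -/
def badGram (m : ℕ) : Set (ZMod n → ℂ) := {ε | (1 / 4) ^ m ≤ gramTrace Λ (2 * m) ε}

/-- The windows for which two distinct columns have a large inner product. -/
def badCoherence (u : ℝ) : Set (ZMod n → ℂ) :=
  {ε | ∃ mu : ZMod n × ZMod n, mu ≠ 0 ∧ u ≤ ‖autocorrelation mu ε‖}

/-- The pairs of a window and a sign pattern for which the window is good but the least squares
certificate is not smaller than `1` at `rho`. -/
def badSign (m : ℕ) (u : ℝ) (rho : ZMod n × ZMod n) : Set ((ZMod n → ℂ) × (Λ → ℂ)) :=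
  {p | p.1 ∉ badGram Λ m ∧ p.1 ∉ badCoherence u ∧ 1 ≤ ‖(certificateMatrix Λ p.1 *ᵥ p.2) rho‖}

lemma measurableSet_badGram (m : ℕ) : MeasurableSet (badGram Λ m) :=
  measurableSet_le measurable_const (continuous_gramTrace Λ (2 * m)).measurable

lemma measurableSet_badCoherence (u : ℝ) :
    MeasurableSet (badCoherence u : Set (ZMod n → ℂ)) := by
  have h : (badCoherence u : Set (ZMod n → ℂ)) =
      ⋃ mu : ZMod n × ZMod n, {ε | mu ≠ 0 ∧ u ≤ ‖autocorrelation mu ε‖} := by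
    ext ε
    simp [badCoherence]
  rw [h]
  exact MeasurableSet.iUnion fun mu => (MeasurableSet.const _).inter
    (measurableSet_le measurable_const (continuous_autocorrelation mu).norm.measurable)

lemma measurableSet_badSign (m : ℕ) (u : ℝ) (rho : ZMod n × ZMod n) :
    MeasurableSet (badSign Λ m u rho) := by
  refine (measurable_fst (measurableSet_badGram Λ m).compl).inter
    ((measurable_fst (measurableSet_badCoherence u).compl).inter
      (measurableSet_le measurable_const (Measurable.norm ?_)))
  simp only [Matrix.mulVec, dotProduct]
  exact Finset.measurable_sum _ fun lam _ =>
    ((measurable_certificateMatrix Λ rho lam).comp measurable_fst).mul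
      ((measurable_pi_apply lam).comp measurable_snd)

/-- A window outside the bad sets has coefficients of the certificate with square sum at most
`4 S u² / n²`, so that the signs produce a value of modulus at least `1` with small probability. -/
lemma measureReal_badSign_le {m : ℕ} {u : ℝ} (hu : 0 < u) (hΛ : 1 ≤ Λ.card)
    {rho : ZMod n × ZMod n} (hrho : rho ∉ Λ) :
    ((phaseMeasure (ZMod n)).prod (phaseMeasure Λ)).real
        {p | (phaseWindow p.1, fun lam => phase (p.2 lam)) ∈ badSign Λ m u rho} ≤
      2 * Real.exp (-(1 / (2 * (4 * Λ.card * (u / n) ^ 2)))) := by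
  have hn0 : (0 : ℝ) < n := by exact_mod_cast NeZero.pos n
  have hS : (0 : ℝ) < Λ.card := by exact_mod_cast hΛ
  have hmeas : Measurable fun p : (ZMod n → AddCircle (2 * Real.pi)) ×
      (Λ → AddCircle (2 * Real.pi)) => (phaseWindow p.1, fun lam => phase (p.2 lam)) :=
    (continuous_phaseWindow.measurable.comp measurable_fst).prodMk
      (measurable_pi_lambda _ fun lam => continuous_phase.measurable.comp
        ((measurable_pi_apply lam).comp measurable_snd))
  refine measureReal_prod_le_of_slice (hmeas (measurableSet_badSign Λ m u rho)) (by positivity)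
    fun θ => ?_
  by_cases hgood : phaseWindow θ ∉ badGram Λ m ∧ phaseWindow θ ∉ badCoherence u
  · have hg : gramTrace Λ (2 * m) (phaseWindow θ) < (1 / 4) ^ m := not_le.mp hgood.1
    have hcoh : ∀ mu : ZMod n × ZMod n, mu ≠ 0 → ‖autocorrelation mu (phaseWindow θ)‖ ≤ u := by
      intro mu hmu
      by_contra hcon
      exact hgood.2 ⟨mu, hmu, (not_le.mp hcon).le⟩
    have hsum := sum_norm_sq_certificateMatrix_le Λ hg hcoh hrho
    have h := measureReal_le_norm_sum_mul_phase
      (fun lam => certificateMatrix Λ (phaseWindow θ) rho lam)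
      (v := 4 * Λ.card * (u / n) ^ 2) (by positivity) hsum zero_le_one
    rw [one_pow] at h
    exact (measureReal_mono fun β hβ => hβ.2.2).trans h
  · refine (measureReal_mono (s₂ := ∅) fun β hβ => (hgood ⟨hβ.1, hβ.2.1⟩).elim).trans ?_
    rw [measureReal_empty]
    positivity

/-- The pairs of a window and a sign pattern for which recovery is not guaranteed. -/
def badPairs (m : ℕ) (u : ℝ) : Set ((ZMod n → ℂ) × (Λ → ℂ)) :=
  Prod.fst ⁻¹' badGram Λ m ∪ Prod.fst ⁻¹' badCoherence u ∪
    ⋃ rho : (Λᶜ : Finset (ZMod n × ZMod n)), badSign Λ m u rho.1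

lemma measurableSet_badPairs (m : ℕ) (u : ℝ) : MeasurableSet (badPairs Λ m u) :=
  ((measurable_fst (measurableSet_badGram Λ m)).union
    (measurable_fst (measurableSet_badCoherence u))).union
      (MeasurableSet.iUnion fun rho => measurableSet_badSign Λ m u rho.1)

lemma basisPursuitRecovers_of_notMem_badPairs {m : ℕ} {u : ℝ} {ε : ZMod n → ℂ}
    {x : ZMod n × ZMod n → ℂ} (hx : Function.support x = (Λ : Set (ZMod n × ZMod n)))
    (h : (ε, fun lam : Λ => complexSgn (x lam.1)) ∉ badPairs Λ m u) :
    BasisPursuitRecovers (gaborMatrix (normalizedWindow ε)) x := by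
  simp only [badPairs, Set.mem_union, Set.mem_preimage, Set.mem_iUnion, not_or, not_exists] at h
  obtain ⟨⟨h1, h2⟩, h3⟩ := h
  refine basisPursuitRecovers_of_certificateMatrix Λ (not_le.mp h1) hx fun rho hrho => ?_
  by_contra hcon
  exact h3 ⟨rho, Finset.mem_compl.mpr hrho⟩ ⟨h1, h2, not_lt.mp hcon⟩

lemma measureReal_badPairs_le {m : ℕ} {u : ℝ} (hu : 0 < u) (hΛ : 1 ≤ Λ.card) :
    ((phaseMeasure (ZMod n)).prod (phaseMeasure Λ)).real
        {p | (phaseWindow p.1, fun lam => phase (p.2 lam)) ∈ badPairs Λ m u} ≤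
      (phaseMeasure (ZMod n)).real {θ | phaseWindow θ ∈ badGram Λ m} +
      (phaseMeasure (ZMod n)).real {θ | phaseWindow θ ∈ badCoherence u} +
      2 * ((n : ℝ) ^ 2 - Λ.card) * Real.exp (-(1 / (2 * (4 * Λ.card * (u / n) ^ 2)))) := by
  set R := (phaseMeasure (ZMod n)).prod (phaseMeasure Λ) with hR
  have hfst : ∀ B : Set (ZMod n → AddCircle (2 * Real.pi)),
      R.real (Prod.fst ⁻¹' B) = (phaseMeasure (ZMod n)).real B := by
    intro B
    rw [← Set.prod_univ, measureReal_prod_prod, probReal_univ, mul_one]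
  have hsub : {p : (ZMod n → AddCircle (2 * Real.pi)) × (Λ → AddCircle (2 * Real.pi)) |
        (phaseWindow p.1, fun lam => phase (p.2 lam)) ∈ badPairs Λ m u} ⊆
      (Prod.fst ⁻¹' {θ | phaseWindow θ ∈ badGram Λ m} ∪
        Prod.fst ⁻¹' {θ | phaseWindow θ ∈ badCoherence u}) ∪
      ⋃ rho : (Λᶜ : Finset (ZMod n × ZMod n)),
        {p | (phaseWindow p.1, fun lam => phase (p.2 lam)) ∈ badSign Λ m u rho.1} := by
    intro p hp
    simpa [badPairs] using hp
  have h1 := measureReal_mono (μ := R) hsub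
  have h2 := measureReal_union_le (μ := R) (Prod.fst ⁻¹' {θ | phaseWindow θ ∈ badGram Λ m} ∪
        Prod.fst ⁻¹' {θ | phaseWindow θ ∈ badCoherence u})
      (⋃ rho : (Λᶜ : Finset (ZMod n × ZMod n)),
        {p | (phaseWindow p.1, fun lam => phase (p.2 lam)) ∈ badSign Λ m u rho.1})
  have h3 := measureReal_union_le (μ := R) (Prod.fst ⁻¹' {θ | phaseWindow θ ∈ badGram Λ m})
        (Prod.fst ⁻¹' {θ | phaseWindow θ ∈ badCoherence u})
  rw [hfst, hfst] at h3
  have h4 : R.real (⋃ rho : (Λᶜ : Finset (ZMod n × ZMod n)),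
        {p | (phaseWindow p.1, fun lam => phase (p.2 lam)) ∈ badSign Λ m u rho.1}) ≤
      2 * ((n : ℝ) ^ 2 - Λ.card) * Real.exp (-(1 / (2 * (4 * Λ.card * (u / n) ^ 2)))) := by
    refine (measureReal_iUnion_fintype_le _).trans ((Finset.sum_le_card_nsmul _ _ _ fun rho _ =>
      measureReal_badSign_le Λ hu hΛ (Finset.mem_compl.mp rho.2)).trans (le_of_eq ?_))
    rw [Finset.card_univ, Fintype.card_coe, Finset.card_compl, Fintype.card_prod, ZMod.card,
      nsmul_eq_mul, Nat.cast_sub]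
    · push_cast
      ring
    · have := Finset.card_le_univ Λ
      rwa [Fintype.card_prod, ZMod.card] at this
  linarith

end Failure

/-- Independent uniform points of the torus, split into two families, are distributed like pairs of
families of independent phases. -/
lemma measureReal_preimage_eq_of_iIndepFun {Ω : Type*} [MeasurableSpace Ω] {P : Measure Ω}
    [IsProbabilityMeasure P] {I J : Type*} [Fintype I] [Fintype J] {Y : I ⊕ J → Ω → ℂ}
    (hY : ∀ i, ProbabilityTheory.HasLaw (Y i) torusUniform P)
    (hindep : ProbabilityTheory.iIndepFun Y P)
    {B : Set ((I → ℂ) × (J → ℂ))} (hB : MeasurableSet B) :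
    P.real {ω | (fun i => Y (Sum.inl i) ω, fun j => Y (Sum.inr j) ω) ∈ B} =
      ((phaseMeasure I).prod (phaseMeasure J)).real
        {p | (fun i => phase (p.1 i), fun j => phase (p.2 j)) ∈ B} := by
  have hY' : ∀ i, AEMeasurable (Y i) P := fun i => (hY i).aemeasurable
  have hlaw : P.map (fun ω i => Y i ω) = (phaseMeasure (I ⊕ J)).map fun θ i => phase (θ i) := by
    rw [(ProbabilityTheory.iIndepFun_iff_map_fun_eq_pi_map hY').mp hindep, ← pi_torusUniform]
    congr 1
    funext i
    exact (hY i).map_eq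
  have hsplit : Measurable fun y : I ⊕ J → ℂ =>
      ((fun i => y (Sum.inl i), fun j => y (Sum.inr j)) : (I → ℂ) × (J → ℂ)) := by fun_prop
  have hphase : Measurable fun (θ : I ⊕ J → AddCircle (2 * Real.pi)) i => phase (θ i) :=
    measurable_pi_lambda _ fun i => continuous_phase.measurable.comp (measurable_pi_apply i)
  have hpair : Measurable fun p : (I → AddCircle (2 * Real.pi)) × (J → AddCircle (2 * Real.pi)) =>
      ((fun i => phase (p.1 i), fun j => phase (p.2 j)) : (I → ℂ) × (J → ℂ)) :=
    (measurable_pi_lambda _ fun i => continuous_phase.measurable.comp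
      ((measurable_pi_apply i).comp measurable_fst)).prodMk
    (measurable_pi_lambda _ fun j => continuous_phase.measurable.comp
      ((measurable_pi_apply j).comp measurable_snd))
  have h1 := map_measureReal_apply_of_aemeasurable (aemeasurable_pi_lambda _ hY') (hsplit hB)
  have hsum := measurePreserving_sumPiEquivProdPi
    (fun _ : I ⊕ J => (haarAddCircle : Measure (AddCircle (2 * Real.pi))))
  have h2 := hsum.measureReal_preimage (hpair hB).nullMeasurableSet
  have h3 : (phaseMeasure (I ⊕ J)).real {θ | (fun i => phase (θ (Sum.inl i)),
      fun j => phase (θ (Sum.inr j))) ∈ B} =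
      (P.map fun ω i => Y i ω).real
        ((fun y : I ⊕ J → ℂ => (fun i => y (Sum.inl i), fun j => y (Sum.inr j))) ⁻¹' B) := by
    rw [hlaw, map_measureReal_apply hphase (hsplit hB)]
    rfl
  exact (h1.symm.trans h3.symm).trans h2

theorem theorem2p1 {Ω : Type*} [MeasurableSpace Ω] (P : MeasureTheory.Measure Ω)
    [MeasureTheory.IsProbabilityMeasure P]
    (n : ℕ) [NeZero n] (hn : Even n)
    (S : ℕ) (Λ : Finset (ZMod n × ZMod n)) (hΛ : Λ.card = S)
    (ε : ZMod n → Ω → ℂ) (x : Ω → ZMod n × ZMod n → ℂ)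
    (hε : ∀ q, ProbabilityTheory.HasLaw (ε q) torusUniform P)
    (hx : ∀ᵐ ω ∂P, Function.support (x ω) = (Λ : Set (ZMod n × ZMod n)))
    (hsgn : ∀ lam ∈ Λ, ProbabilityTheory.HasLaw (fun ω => complexSgn (x ω lam)) torusUniform P)
    (hindep : ProbabilityTheory.iIndepFun
      (Sum.elim ε (fun (lam : Λ) (ω : Ω) => complexSgn (x ω (lam : ZMod n × ZMod n)))) P)
    (σ : ℝ) (hσ : 8 < σ) :
    P.real {ω | ¬ BasisPursuitRecovers (gaborMatrix (normalizedWindow fun q => ε q ω)) (x ω)} ≤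
      2 * ((n : ℝ) ^ 2 - S) * Real.exp (-((n : ℝ) / (8 * σ * S * Real.log n)))
        + Real.exp 1 ^ 2 / (4 * (Real.exp 1 - 1)) * S *
            Real.exp (-((n : ℝ) / (16 * Real.exp 1 * S)))
        + 4 * (n : ℝ) ^ (-(σ / 4 - 2)) := by
  subst hΛ
  have hn2 : 2 ≤ n := by
    obtain ⟨k, hk⟩ := hn
    have := NeZero.pos n
    omega
  have hn0 : (0 : ℝ) < n := by exact_mod_cast NeZero.pos n
  have hlog : 0 < Real.log n := Real.log_pos (by exact_mod_cast hn2)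
  have hσ0 : 0 < σ := by linarith
  have hC := one_le_exp_sq_div
  have hcard : (Λ.card : ℝ) ≤ (n : ℝ) ^ 2 := by
    have h := Finset.card_le_univ Λ
    rw [Fintype.card_prod, ZMod.card, ← sq] at h
    exact_mod_cast h
  rcases Nat.eq_zero_or_pos Λ.card with h0 | hpos
  · -- For empty `Λ` the vector `x` vanishes almost surely, and `0` is always recovered.
    have hzero : P.real {ω | ¬ BasisPursuitRecovers
        (gaborMatrix (normalizedWindow fun q => ε q ω)) (x ω)} = 0 := by
      rw [measureReal_def, ENNReal.toReal_eq_zero_iff]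
      refine Or.inl (ae_iff.mp ?_)
      filter_upwards [hx] with ω hω
      have hx0 : ∀ i, x ω i = 0 := by
        rw [Finset.card_eq_zero.mp h0, Finset.coe_empty, Function.support_eq_empty_iff] at hω
        exact fun i => congrFun hω i
      refine basisPursuitRecovers_of_certificate _ _ 0 (fun i hi => absurd (hx0 i) hi)
        (fun i _ => by simp) fun v _ hv => funext fun i => hv i (hx0 i)
    rw [hzero]
    have h1 : 0 ≤ (n : ℝ) ^ 2 - Λ.card := by linarith
    positivity
  · obtain ⟨m, hm⟩ := exists_measureReal_gramTrace_le Λ hpos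
    set u := Real.sqrt (n * σ * Real.log n) with hu
    have hu0 : 0 < u := Real.sqrt_pos.mpr (by positivity)
    have hcoh := measureReal_autocorrelation_le hn2 hσ0
    have hY : ∀ i, ProbabilityTheory.HasLaw ((Sum.elim ε (fun (lam : Λ) (ω : Ω) =>
        complexSgn (x ω (lam : ZMod n × ZMod n)))) i) torusUniform P := by
      rintro (q | lam)
      · exact hε q
      · exact hsgn lam.1 lam.2
    have hprob := measureReal_preimage_eq_of_iIndepFun hY hindep (measurableSet_badPairs Λ m u)
    have hbad := measureReal_badPairs_le Λ (m := m) hu0 hpos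
    have hle : P.real {ω | ¬ BasisPursuitRecovers
        (gaborMatrix (normalizedWindow fun q => ε q ω)) (x ω)} ≤
        P.real {ω | ((fun q => ε q ω, fun lam : Λ => complexSgn (x ω lam.1)) :
          (ZMod n → ℂ) × (Λ → ℂ)) ∈ badPairs Λ m u} := by
      refine ENNReal.toReal_mono (measure_ne_top _ _) (measure_mono_ae ?_)
      filter_upwards [hx] with ω hω hfail
      by_contra hcon
      exact hfail (basisPursuitRecovers_of_notMem_badPairs Λ hω hcon)
    have hexp : 1 / (2 * (4 * (Λ.card : ℝ) * (u / n) ^ 2)) =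
        n / (8 * σ * Λ.card * Real.log n) := by
      have hS : (0 : ℝ) < Λ.card := by exact_mod_cast hpos
      rw [div_pow, hu, Real.sq_sqrt (by positivity)]
      field_simp
      norm_num
    rw [hexp] at hbad
    have hm' : (phaseMeasure (ZMod n)).real {θ | phaseWindow θ ∈ badGram Λ m} ≤ _ := hm
    have hcoh' : (phaseMeasure (ZMod n)).real {θ | phaseWindow θ ∈ badCoherence u} ≤ _ := hcoh
    refine hle.trans ((le_of_eq hprob).trans ?_)
    refine hbad.trans ?_
    linarith
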